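/- **Setting.** Let $I\subset\mathbf R$ be an open interval containing $0$ and let $x\mapsto s(t)A(t)x+d(t)$, $t\in I$, be a one-parameter equiform motion of Euclidean space $\mathbf E^7$ of class $C^1$, with $s(t)>0$, $A(t)$ an orthogonal $7\times7$ matrix, $d(t)\in\mathbf E^7$, and $s(0)=1$, $A(0)=\mathrm{Id}$, $d(0)=0$. Put $s'=\dot s(0)$, $d'=\dot d(0)=(b'_1,\dots,b'_7)^{T}$ and let $\Omega=\dot A(0)$, a skew-symmetric matrix whose entries above the diagonal, numbered row by row, are $\omega_1,\dots,\omega_{21}$ (so $\Omega_{12}=\omega_1,\dots,\Omega_{17}=\omega_6$, $\Omega_{23}=\omega_7,\dots,\Omega_{27}=\omega_{11}$, $\Omega_{34}=\omega_{12},\dots,\Omega_{37}=\omega_{15}$, and so on). Let $$x(\theta,\phi)=(\cos\theta\cos\phi,\ \sin\theta\cos\phi,\ \sin\phi,\ 0,0,0,0)^{T}$$ parametrize the unit sphere of the coordinate space $[x_1x_2x_3]$. The associated kinematic 3-surface is the first order representation of the motion of this sphere at $t=0$, $$X(t,\theta,\phi)=\bigl[\mathrm{Id}+t\,(s'\,\mathrm{Id}+\Omega)\bigr]x(\theta,\phi)+t\,d'.$$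 Let $\mathbf K(t,\theta,\phi)$ denote the scalar curvature of the first fundamental form $g$ of $X$ in the coordinates $(t,\theta,\phi)$. **Theorem.** Assume that the surface is foliated by spheres, i.e. for all $t$ sufficiently close to $0$ the slice $\{X(t,\theta,\phi):\theta,\phi\in\mathbf R\}$ is a round 2-sphere (of positive radius, in a 3-dimensional affine subspace), that there is no translation in the 3-space containing the starting sphere, i.e. $b'_1=b'_2=b'_3=0$, and that the scalar curvature vanishes at the zero position: $\mathbf K(0,\theta,\phi)=0$ for all $(\theta,\phi)$ at which $g$ is nondegenerate. Then $$\omega_1=\omega_2=\omega_7=0,$$ $$\sum_{i=4}^{7}b'_i\,\omega_{i-1}=\sum_{i=4}^{7}b'_i\,\omega_{i+4}=\sum_{i=4}^{7}b'_i\,\omega_{i+8}=0,$$ $$\sum_{i=3}^{6}\omega_i^2=\sum_{i=4}^{7}b_i'^{\,2}.$$ -/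

import Mathlib

open scoped Topology Matrix

noncomputable section

/-- Euclidean 7-space. -/
abbrev E7 : Type := EuclideanSpace ℝ (Fin 7)

namespace LocalGeometry

/-- The `i`-th partial derivative of a vector-valued function on `ℝⁿ`. -/
def pderiv {n : ℕ} {F : Type*} [NormedAddCommGroup F] [NormedSpace ℝ F]
    (i : Fin n) (f : (Fin n → ℝ) → F) (p : Fin n → ℝ) : F :=
  deriv (fun τ : ℝ => f (Function.update p i τ)) (p i)

/-- First fundamental form `g i j = ⟪∂ᵢ X, ∂ⱼ X⟫` of a parametrized surface `X`. -/
def metric {n : ℕ} (X : (Fin n → ℝ) → E7) (p : Fin n → ℝ) : Matrix (Fin n) (Fin n) ℝ :=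
  Matrix.of fun i j => inner ℝ (pderiv i X p) (pderiv j X p)

/-- Christoffel symbols of the second kind, `christoffel X l i j p = Γ^l_{ij}(p)`. -/
def christoffel {n : ℕ} (X : (Fin n → ℝ) → E7) (l i j : Fin n) (p : Fin n → ℝ) : ℝ :=
  (1 / 2) * ∑ m : Fin n, (metric X p)⁻¹ l m *
    (pderiv j (fun q => metric X q i m) p + pderiv i (fun q => metric X q j m) p
      - pderiv m (fun q => metric X q i j) p)

/-- Ricci tensor
`∂_l Γ^l_{ij} - ∂_j Γ^l_{il} + Γ^l_{ij} Γ^m_{lm} - Γ^m_{il} Γ^l_{jm}` (sums over `l`, `m`). -/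
def ricci {n : ℕ} (X : (Fin n → ℝ) → E7) (i j : Fin n) (p : Fin n → ℝ) : ℝ :=
  ∑ l : Fin n, (pderiv l (christoffel X l i j) p - pderiv j (christoffel X l i l) p
    + ∑ m : Fin n, (christoffel X l i j p * christoffel X m l m p
      - christoffel X m i l p * christoffel X l j m p))

/-- Scalar curvature `g^{ij} Ric_{ij}`; meaningful where the first fundamental form is
invertible. -/
def scalarCurvature {n : ℕ} (X : (Fin n → ℝ) → E7) (p : Fin n → ℝ) : ℝ :=
  ∑ i : Fin n, ∑ j : Fin n, (metric X p)⁻¹ i j * ricci X i j p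

/-- A round 2-sphere in `E⁷`: the points at a fixed positive distance from a centre `c` in a
3-dimensional affine subspace through `c`. -/
def IsTwoSphere (S : Set E7) : Prop :=
  ∃ (c : E7) (r : ℝ) (W : Submodule ℝ E7), 0 < r ∧ Module.finrank ℝ W = 3 ∧
    S = {p : E7 | p - c ∈ W ∧ ‖p - c‖ = r}

end LocalGeometry

/-- The unit sphere `k₀` of the coordinate 3-space `[x₁x₂x₃]` in `E⁷`. -/
def sphereParam (θ φ : ℝ) : E7 :=
  !₂[Real.cos θ * Real.cos φ, Real.sin θ * Real.cos φ, Real.sin φ, 0, 0, 0, 0]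

/-- A one-parameter equiform motion `x ↦ s(t) A(t) x + d(t)` of `E⁷` of class `C¹`, on an open
interval `I` containing `0`, whose moving and fixed frames coincide at `t = 0`. -/
structure EquiformMotion where
  I : Set ℝ
  isOpen_I : IsOpen I
  ordConnected_I : I.OrdConnected
  zero_mem_I : (0 : ℝ) ∈ I
  s : ℝ → ℝ
  A : ℝ → Matrix (Fin 7) (Fin 7) ℝ
  d : ℝ → E7
  s_pos : ∀ t ∈ I, 0 < s t
  A_orthogonal : ∀ t ∈ I, A t ∈ Matrix.orthogonalGroup (Fin 7) ℝ
  contDiffOn_s : ContDiffOn ℝ 1 s I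
  contDiffOn_A : ∀ i j, ContDiffOn ℝ 1 (fun t => A t i j) I
  contDiffOn_d : ContDiffOn ℝ 1 d I
  s_zero : s 0 = 1
  A_zero : A 0 = 1
  d_zero : d 0 = 0

namespace EquiformMotion

/-- `s' = ṡ(0)`. -/
def s' (M : EquiformMotion) : ℝ := deriv M.s 0

/-- `Ω = Ȧ(0)`. -/
def Omega (M : EquiformMotion) : Matrix (Fin 7) (Fin 7) ℝ :=
  Matrix.of fun i j => deriv (fun t => M.A t i j) 0

/-- `d' = ḋ(0)`. -/
def d' (M : EquiformMotion) : E7 := deriv M.d 0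

/-- The coordinates `b'₁, …, b'₇` of `d'`, numbered from `1`. -/
def b' (M : EquiformMotion) : ℕ → ℝ
  | 1 => M.d' 0
  | 2 => M.d' 1
  | 3 => M.d' 2
  | 4 => M.d' 3
  | 5 => M.d' 4
  | 6 => M.d' 5
  | 7 => M.d' 6
  | _ => 0

/-- The entries `ω₁, …, ω₂₁` of `Ω` above the diagonal, numbered row by row from `1`. -/
def ω (M : EquiformMotion) : ℕ → ℝ
  | 1 => M.Omega 0 1
  | 2 => M.Omega 0 2
  | 3 => M.Omega 0 3
  | 4 => M.Omega 0 4
  | 5 => M.Omega 0 5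
  | 6 => M.Omega 0 6
  | 7 => M.Omega 1 2
  | 8 => M.Omega 1 3
  | 9 => M.Omega 1 4
  | 10 => M.Omega 1 5
  | 11 => M.Omega 1 6
  | 12 => M.Omega 2 3
  | 13 => M.Omega 2 4
  | 14 => M.Omega 2 5
  | 15 => M.Omega 2 6
  | 16 => M.Omega 3 4
  | 17 => M.Omega 3 5
  | 18 => M.Omega 3 6
  | 19 => M.Omega 4 5
  | 20 => M.Omega 4 6
  | 21 => M.Omega 5 6
  | _ => 0

/-- The kinematic 3-surface: the first order representation at `t = 0` of the motion of `k₀`,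
`X(t, θ, φ) = [I + t (s' I + Ω)] x(θ, φ) + t d'`. -/
def X (M : EquiformMotion) (t θ φ : ℝ) : E7 :=
  WithLp.toLp 2 ((1 + t • (M.s' • (1 : Matrix (Fin 7) (Fin 7) ℝ) + M.Omega)) *ᵥ
    (sphereParam θ φ).ofLp) + t • M.d'

/-- The kinematic 3-surface as a map of the coordinates `(x₁, x₂, x₃) = (t, θ, φ)`. -/
def surface (M : EquiformMotion) (p : Fin 3 → ℝ) : E7 := M.X (p 0) (p 1) (p 2)

/-- For all `t` near `0`, the slice `t = const` of the kinematic surface is a round 2-sphere. -/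
def FoliatedBySpheres (M : EquiformMotion) : Prop :=
  ∀ᶠ t in 𝓝 (0 : ℝ), LocalGeometry.IsTwoSphere (Set.range fun q : ℝ × ℝ => M.X t q.1 q.2)

end EquiformMotion

end

/-! The slice at time `t` is the image of the unit sphere under `e i ↦ e i + t • w i`, translated by
`t • d'`, so it is point-symmetric about `t • d'`. If one slice with `t ≠ 0` is a round sphere, its
centre must be `t • d'`, and this forces the velocities `w i` to be pairwise orthogonal with a
common squared length `s'² + l` (`exists_inner_velocity_eq`). The metric then depends only on `s'`,
`l`, `k = s'² + l + |d'|²`, the rotation vector `c` of the starting sphere (up to sign `ω₇, ω₂, ω₁`)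
and the products `m i = ⟪w i, d'⟫` (up to sign the three sums of the theorem); this is `kinMetric`.

At `t = 0` the inverse metric is diagonal in a simple frame, and the scalar curvature is a
polynomial over `D²`, where `D` is the squared length of the part of `∂ₜX` orthogonal to the slice.
The numerator times `D` vanishes everywhere, degenerate points included, so its top coefficients can
be read off. On the equator the top harmonic in `θ` is a multiple of `(c₁ + i c₂)⁶`; once this is
zero it becomes a multiple of `(m₁ + i m₂)³`. The metric is then independent of `θ`, and along a
meridian the identity is polynomial in `sin φ`, with leading coefficient `6 c₃⁶`, then `12 m₃³`, and
finally the constant `2k²(k - s'² - 2l)`.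

If `k = s'² + 2l`, then `|d'|² = l`, which is the last claim because `l = ∑ ωᵢ²` once the rotation
vanishes. If `k = 0`, all velocities and `d'` vanish. -/

noncomputable section

namespace LocalGeometry

/-! ### Scalar curvature as a function of the 2-jet of the metric -/

section InverseDerivative

open scoped Matrix.Norms.Operator

/-- The entries of `A⁻¹` have derivatives `-(A⁻¹ A' A⁻¹)`. -/
theorem hasDerivAt_inv_apply {n : ℕ} {A : ℝ → Matrix (Fin n) (Fin n) ℝ}
    {A' : Matrix (Fin n) (Fin n) ℝ} {t : ℝ}
    (hA : ∀ i j, HasDerivAt (fun τ => A τ i j) (A' i j) t) (hdet : (A t).det ≠ 0)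
    (i j : Fin n) :
    HasDerivAt (fun τ => (A τ)⁻¹ i j) (-((A t)⁻¹ * A' * (A t)⁻¹) i j) t := by
  have hA' : HasDerivAt A A' t := hasDerivAt_pi.2 fun i => hasDerivAt_pi.2 fun j => hA i j
  have hu : IsUnit (A t) := (Matrix.isUnit_iff_isUnit_det _).2 hdet.isUnit
  obtain ⟨u, hu⟩ := hu
  -- The operator norm makes matrices a complete normed algebra, where inversion is differentiable
  -- at units.
  have h1 := hasFDerivAt_ringInverse (𝕜 := ℝ) u
  rw [hu] at h1
  have h2 := h1.comp_hasDerivAt t hA'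
  have h3 : (↑u⁻¹ : Matrix (Fin n) (Fin n) ℝ) = (A t)⁻¹ := by
    rw [← hu, Matrix.coe_units_inv]
  have h4 := hasDerivAt_pi.1 (hasDerivAt_pi.1 h2 i) j
  simp only [Function.comp_def, ← Matrix.nonsing_inv_eq_ringInverse] at h4
  simpa [h3] using h4

end InverseDerivative

/-- The Christoffel symbol `Γ^l_{ij}` as a function of the inverse metric `I` and of the first
derivatives `d k = ∂ₖ g`. -/
def jetChristoffel {n : ℕ} (I : Matrix (Fin n) (Fin n) ℝ) (d : Fin n → Matrix (Fin n) (Fin n) ℝ)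
    (l i j : Fin n) : ℝ :=
  (1 / 2) * ∑ m : Fin n, I l m * (d j i m + d i j m - d m i j)

/-- The derivative `∂ₖ Γ^l_{ij}` as a function of the inverse metric and of the derivatives
`d k = ∂ₖ g`, `dd k l = ∂ₖ ∂ₗ g`. -/
def jetDChristoffel {n : ℕ} (I : Matrix (Fin n) (Fin n) ℝ)
    (d : Fin n → Matrix (Fin n) (Fin n) ℝ) (dd : Fin n → Fin n → Matrix (Fin n) (Fin n) ℝ)
    (k l i j : Fin n) : ℝ :=
  (1 / 2) * ∑ m : Fin n, (-(I * d k * I) l m * (d j i m + d i j m - d m i j)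
    + I l m * (dd k j i m + dd k i j m - dd k m i j))

/-- The scalar curvature as a function of the inverse metric and of the derivatives of the
metric. -/
def jetScalar {n : ℕ} (I : Matrix (Fin n) (Fin n) ℝ)
    (d : Fin n → Matrix (Fin n) (Fin n) ℝ) (dd : Fin n → Fin n → Matrix (Fin n) (Fin n) ℝ) : ℝ :=
  ∑ i : Fin n, ∑ j : Fin n, I i j * ∑ l : Fin n,
    (jetDChristoffel I d dd l l i j - jetDChristoffel I d dd j l i l
      + ∑ m : Fin n, (jetChristoffel I d l i j * jetChristoffel I d m l m
        - jetChristoffel I d m i l * jetChristoffel I d l j m))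

/-- The formula `hchr` holds at every point, even where the inverse has its default value, since
both sides use the same `⁻¹`. Invertibility is needed only at `p`, to differentiate the inverse
there. -/
theorem scalarCurvature_eq_jetScalar {n : ℕ} (X : (Fin n → ℝ) → E7)
    (G : (Fin n → ℝ) → Matrix (Fin n) (Fin n) ℝ)
    (d : Fin n → (Fin n → ℝ) → Matrix (Fin n) (Fin n) ℝ)
    (dd : Fin n → Fin n → Matrix (Fin n) (Fin n) ℝ) (p : Fin n → ℝ)
    (hG : ∀ q, metric X q = G q)
    (hd : ∀ q k i j, HasDerivAt (fun τ => G (Function.update q k τ) i j) (d k q i j) (q k))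
    (hdd : ∀ k l i j, HasDerivAt (fun τ => d l (Function.update p k τ) i j) (dd k l i j) (p k))
    (hdet : (G p).det ≠ 0) :
    scalarCurvature X p = jetScalar (G p)⁻¹ (fun k => d k p) dd := by
  have hchr : ∀ l i j q, christoffel X l i j q =
      jetChristoffel (G q)⁻¹ (fun k => d k q) l i j := by
    intro l i j q
    have h : ∀ k i j, pderiv k (fun q => G q i j) q = d k q i j := fun k i j => (hd q k i j).deriv
    simp only [christoffel, jetChristoffel, hG, h]
  have hdchr : ∀ k l i j, pderiv k (christoffel X l i j) p =
      jetDChristoffel (G p)⁻¹ (fun k => d k p) dd k l i j := by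
    intro k l i j
    have hup : Function.update p k (p k) = p := Function.update_eq_self k p
    simp only [pderiv, hchr, jetChristoffel]
    refine HasDerivAt.deriv ?_
    refine HasDerivAt.const_mul _ (HasDerivAt.fun_sum fun m _ => ?_)
    have hI := hasDerivAt_inv_apply (A := fun τ => G (Function.update p k τ)) (A' := d k p)
      (t := p k) (fun i j => hd p k i j) (by simpa only [hup] using hdet) l m
    have h := hI.mul (((hdd k j i m).add (hdd k i j m)).sub (hdd k m i j))
    simp only [hup, Pi.add_apply, Pi.sub_apply] at h
    exact h
  have hgi : metric X p = G p := hG p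
  simp only [scalarCurvature, ricci, hchr, hdchr, hgi, jetScalar]

/-! ### The model metric `kinMetric` and its derivatives -/

/-- The component of the horizontal part of a vector in the direction `(cos θ, sin θ)`. -/
def radial (a b θ : ℝ) : ℝ := a * Real.cos θ + b * Real.sin θ

/-- The component of the horizontal part of a vector in the direction `(-sin θ, cos θ)`. -/
def tangential (a b θ : ℝ) : ℝ := -a * Real.sin θ + b * Real.cos θ

theorem hasDerivAt_radial (a b θ : ℝ) : HasDerivAt (radial a b) (tangential a b θ) θ := by
  have h := ((Real.hasDerivAt_cos θ).const_mul a).add ((Real.hasDerivAt_sin θ).const_mul b)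
  refine h.congr_deriv ?_
  simp [tangential]

theorem hasDerivAt_tangential (a b θ : ℝ) : HasDerivAt (tangential a b) (-radial a b θ) θ := by
  have h := ((Real.hasDerivAt_sin θ).const_mul (-a)).add ((Real.hasDerivAt_cos θ).const_mul b)
  refine h.congr_deriv ?_
  simp only [radial]
  ring

@[fun_prop]
theorem differentiableAt_radial (a b θ : ℝ) : DifferentiableAt ℝ (radial a b) θ :=
  (hasDerivAt_radial a b θ).differentiableAt

@[fun_prop]
theorem differentiableAt_tangential (a b θ : ℝ) : DifferentiableAt ℝ (tangential a b) θ :=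
  (hasDerivAt_tangential a b θ).differentiableAt

@[simp]
theorem deriv_radial (a b θ : ℝ) : deriv (radial a b) θ = tangential a b θ :=
  (hasDerivAt_radial a b θ).deriv

@[simp]
theorem deriv_tangential (a b θ : ℝ) : deriv (tangential a b) θ = -radial a b θ :=
  (hasDerivAt_tangential a b θ).deriv

/-- The square of the radius of the sphere at time `t`. -/
def radiusSq (s l t : ℝ) : ℝ := (1 + t * s) ^ 2 + t ^ 2 * l

/-- The derivative of `radiusSq`. -/
def radiusSqDeriv (s l t : ℝ) : ℝ := 2 * s * (1 + t * s) + 2 * t * l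

theorem hasDerivAt_radiusSq (s l t : ℝ) :
    HasDerivAt (radiusSq s l) (radiusSqDeriv s l t) t := by
  have h := ((((hasDerivAt_id t).mul_const s).const_add 1).pow 2).add
    (((hasDerivAt_id t).pow 2).mul_const l)
  refine h.congr_deriv ?_
  simp [radiusSqDeriv]
  ring

theorem hasDerivAt_radiusSqDeriv (s l t : ℝ) :
    HasDerivAt (radiusSqDeriv s l) (2 * s ^ 2 + 2 * l) t := by
  have h := ((((hasDerivAt_id t).mul_const s).const_add 1).const_mul (2 * s)).add
    (((hasDerivAt_id t).const_mul 2).mul_const l)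
  refine h.congr_deriv ?_
  ring

@[fun_prop]
theorem differentiableAt_radiusSq (s l t : ℝ) : DifferentiableAt ℝ (radiusSq s l) t :=
  (hasDerivAt_radiusSq s l t).differentiableAt

@[fun_prop]
theorem differentiableAt_radiusSqDeriv (s l t : ℝ) : DifferentiableAt ℝ (radiusSqDeriv s l) t :=
  (hasDerivAt_radiusSqDeriv s l t).differentiableAt

@[simp]
theorem deriv_radiusSq (s l t : ℝ) : deriv (radiusSq s l) t = radiusSqDeriv s l t :=
  (hasDerivAt_radiusSq s l t).deriv

@[simp]
theorem deriv_radiusSqDeriv (s l t : ℝ) : deriv (radiusSqDeriv s l) t = 2 * s ^ 2 + 2 * l :=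
  (hasDerivAt_radiusSqDeriv s l t).deriv

/-- A symmetric matrix with vanishing entry at `(1, 2)`. -/
def symm₃ (a P Q E G : ℝ) : Matrix (Fin 3) (Fin 3) ℝ := !![a, P, Q; P, E, 0; Q, 0, G]

/-- The first fundamental form of a kinematic surface foliated by spheres, in terms of the
rotation vector `(c₁, c₂, c₃)` of the starting sphere and of the vector `(m₁, m₂, m₃)` of scalar
products of the velocities with the translation. -/
def kinMetric (k l s c₁ c₂ c₃ m₁ m₂ m₃ : ℝ) (p : Fin 3 → ℝ) : Matrix (Fin 3) (Fin 3) ℝ :=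
  symm₃
    (k + 2 * (radial m₁ m₂ (p 1) * Real.cos (p 2) + m₃ * Real.sin (p 2)))
    (Real.cos (p 2) * (c₃ * Real.cos (p 2) - radial c₁ c₂ (p 1) * Real.sin (p 2))
      + p 0 * (Real.cos (p 2) * tangential m₁ m₂ (p 1)))
    (-tangential c₁ c₂ (p 1)
      + p 0 * (-radial m₁ m₂ (p 1) * Real.sin (p 2) + m₃ * Real.cos (p 2)))
    (radiusSq s l (p 0) * Real.cos (p 2) ^ 2)
    (radiusSq s l (p 0))

/-- The first derivatives of `kinMetric`. -/
def kinMetricD (l s c₁ c₂ c₃ m₁ m₂ m₃ : ℝ) (p : Fin 3 → ℝ) :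
    Fin 3 → Matrix (Fin 3) (Fin 3) ℝ :=
  ![symm₃ 0 (Real.cos (p 2) * tangential m₁ m₂ (p 1))
      (-radial m₁ m₂ (p 1) * Real.sin (p 2) + m₃ * Real.cos (p 2))
      (radiusSqDeriv s l (p 0) * Real.cos (p 2) ^ 2) (radiusSqDeriv s l (p 0)),
    symm₃ (2 * tangential m₁ m₂ (p 1) * Real.cos (p 2))
      (-tangential c₁ c₂ (p 1) * Real.cos (p 2) * Real.sin (p 2)
        - p 0 * Real.cos (p 2) * radial m₁ m₂ (p 1))
      (radial c₁ c₂ (p 1) - p 0 * tangential m₁ m₂ (p 1) * Real.sin (p 2)) 0 0,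
    symm₃ (2 * (-radial m₁ m₂ (p 1) * Real.sin (p 2) + m₃ * Real.cos (p 2)))
      (-2 * c₃ * Real.cos (p 2) * Real.sin (p 2)
        - radial c₁ c₂ (p 1) * (Real.cos (p 2) ^ 2 - Real.sin (p 2) ^ 2)
        - p 0 * Real.sin (p 2) * tangential m₁ m₂ (p 1))
      (p 0 * (-radial m₁ m₂ (p 1) * Real.cos (p 2) - m₃ * Real.sin (p 2)))
      (-2 * radiusSq s l (p 0) * Real.cos (p 2) * Real.sin (p 2)) 0]

/-- The second derivatives of `kinMetric`. -/
def kinMetricDD (l s c₁ c₂ c₃ m₁ m₂ m₃ : ℝ) (p : Fin 3 → ℝ) :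
    Fin 3 → Fin 3 → Matrix (Fin 3) (Fin 3) ℝ :=
  let tθ := symm₃ 0 (-Real.cos (p 2) * radial m₁ m₂ (p 1))
    (-tangential m₁ m₂ (p 1) * Real.sin (p 2)) 0 0
  let tφ := symm₃ 0 (-Real.sin (p 2) * tangential m₁ m₂ (p 1))
    (-radial m₁ m₂ (p 1) * Real.cos (p 2) - m₃ * Real.sin (p 2))
    (-2 * radiusSqDeriv s l (p 0) * Real.cos (p 2) * Real.sin (p 2)) 0
  let θφ := symm₃ (-2 * tangential m₁ m₂ (p 1) * Real.sin (p 2))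
    (-tangential c₁ c₂ (p 1) * (Real.cos (p 2) ^ 2 - Real.sin (p 2) ^ 2)
      + p 0 * Real.sin (p 2) * radial m₁ m₂ (p 1))
    (-p 0 * tangential m₁ m₂ (p 1) * Real.cos (p 2)) 0 0
  ![![symm₃ 0 0 0 ((2 * s ^ 2 + 2 * l) * Real.cos (p 2) ^ 2) (2 * s ^ 2 + 2 * l), tθ, tφ],
    ![tθ, symm₃ (-2 * radial m₁ m₂ (p 1) * Real.cos (p 2))
        (radial c₁ c₂ (p 1) * Real.cos (p 2) * Real.sin (p 2)
          - p 0 * Real.cos (p 2) * tangential m₁ m₂ (p 1))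
        (tangential c₁ c₂ (p 1) + p 0 * radial m₁ m₂ (p 1) * Real.sin (p 2)) 0 0, θφ],
    ![tφ, θφ, symm₃ (2 * (-radial m₁ m₂ (p 1) * Real.cos (p 2) - m₃ * Real.sin (p 2)))
        (-2 * c₃ * (Real.cos (p 2) ^ 2 - Real.sin (p 2) ^ 2)
          + 4 * radial c₁ c₂ (p 1) * Real.cos (p 2) * Real.sin (p 2)
          - p 0 * Real.cos (p 2) * tangential m₁ m₂ (p 1))
        (p 0 * (radial m₁ m₂ (p 1) * Real.sin (p 2) - m₃ * Real.cos (p 2)))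
        (-2 * radiusSq s l (p 0) * (Real.cos (p 2) ^ 2 - Real.sin (p 2) ^ 2)) 0]]

theorem hasDerivAt_symm₃ {a P Q E G : ℝ → ℝ} {a' P' Q' E' G' t : ℝ}
    (ha : HasDerivAt a a' t) (hP : HasDerivAt P P' t) (hQ : HasDerivAt Q Q' t)
    (hE : HasDerivAt E E' t) (hG : HasDerivAt G G' t) (i j : Fin 3) :
    HasDerivAt (fun τ => symm₃ (a τ) (P τ) (Q τ) (E τ) (G τ) i j) (symm₃ a' P' Q' E' G' i j) t := by
  fin_cases i <;> fin_cases j <;> first | assumption | exact hasDerivAt_const t 0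

/-- Turns derivative claims into equations for `deriv`, which `simp` can evaluate. -/
theorem hasDerivAt_of_eq_deriv {f : ℝ → ℝ} {f' t : ℝ} (hf : DifferentiableAt ℝ f t)
    (h : deriv f t = f') : HasDerivAt f f' t :=
  h ▸ hf.hasDerivAt

theorem hasDerivAt_kinMetric (k l s c₁ c₂ c₃ m₁ m₂ m₃ : ℝ) (p : Fin 3 → ℝ) (a i j : Fin 3) :
    HasDerivAt (fun τ => kinMetric k l s c₁ c₂ c₃ m₁ m₂ m₃ (Function.update p a τ) i j)
      (kinMetricD l s c₁ c₂ c₃ m₁ m₂ m₃ p a i j) (p a) := by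
  fin_cases a <;>
  · refine hasDerivAt_symm₃ ?_ ?_ ?_ ?_ ?_ i j <;>
    · try simp [Function.update]
      refine hasDerivAt_of_eq_deriv (by fun_prop) ?_
      try simp (disch := fun_prop) [deriv_fun_add, deriv_fun_sub, deriv_fun_mul, deriv_fun_pow]
      try first | ring1 | exact Or.inl (by ring1)

theorem hasDerivAt_kinMetricD (l s c₁ c₂ c₃ m₁ m₂ m₃ : ℝ) (p : Fin 3 → ℝ) (a b i j : Fin 3) :
    HasDerivAt (fun τ => kinMetricD l s c₁ c₂ c₃ m₁ m₂ m₃ (Function.update p a τ) b i j)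
      (kinMetricDD l s c₁ c₂ c₃ m₁ m₂ m₃ p a b i j) (p a) := by
  fin_cases a <;> fin_cases b <;>
  · refine hasDerivAt_symm₃ ?_ ?_ ?_ ?_ ?_ i j <;>
    · try simp [Function.update]
      refine hasDerivAt_of_eq_deriv (by fun_prop) ?_
      try simp (disch := fun_prop) [deriv_fun_add, deriv_fun_sub, deriv_fun_mul, deriv_fun_pow]
      try ring1

/-! ### Curvature through Christoffel symbols of the first kind in a diagonalizing frame -/

/-- Christoffel symbols of the first kind as a function of the derivatives of the metric. -/
def firstKind {n : ℕ} (d : Fin n → Matrix (Fin n) (Fin n) ℝ) (i j m : Fin n) : ℝ :=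
  (d j i m + d i j m - d m i j) / 2

theorem firstKind_symm {n : ℕ} {d : Fin n → Matrix (Fin n) (Fin n) ℝ}
    (hd : ∀ k i j, d k i j = d k j i) (i j m : Fin n) : firstKind d i j m = firstKind d j i m := by
  simp only [firstKind, hd m i j]
  ring

theorem firstKind_add {n : ℕ} {d : Fin n → Matrix (Fin n) (Fin n) ℝ}
    (hd : ∀ k i j, d k i j = d k j i) (k i j : Fin n) :
    d k i j = firstKind d k i j + firstKind d k j i := by
  simp only [firstKind, hd k j i]
  ring

theorem jetChristoffel_eq {n : ℕ} (I : Matrix (Fin n) (Fin n) ℝ)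
    (d : Fin n → Matrix (Fin n) (Fin n) ℝ) (l i j : Fin n) :
    jetChristoffel I d l i j = ∑ m, I l m * firstKind d i j m := by
  simp only [jetChristoffel, firstKind, Finset.mul_sum]
  exact Finset.sum_congr rfl fun m _ => by ring

/-- Lower the index: differentiating the inverse metric gives `-I * d k * I`, and `firstKind_add`
splits `d k` into two symbols, one of which contracts to `Γ^l_{km}`. -/
theorem jetDChristoffel_eq {n : ℕ} (I : Matrix (Fin n) (Fin n) ℝ)
    {d : Fin n → Matrix (Fin n) (Fin n) ℝ} (dd : Fin n → Fin n → Matrix (Fin n) (Fin n) ℝ)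
    (hd : ∀ k i j, d k i j = d k j i) (k l i j : Fin n) :
    jetDChristoffel I d dd k l i j = ∑ m, I l m * firstKind (dd k) i j m
      - ∑ m, (∑ a, I l a * firstKind d k a m + jetChristoffel I d l k m)
        * jetChristoffel I d m i j := by
  have h1 : ∀ m, ∑ a, I l a * firstKind d k a m + jetChristoffel I d l k m = (I * d k) l m := by
    intro m
    rw [jetChristoffel_eq, ← Finset.sum_add_distrib, Matrix.mul_apply]
    exact Finset.sum_congr rfl fun a _ => by rw [firstKind_add hd k a m]; ring
  simp only [h1]
  have h2 : ∑ m, (I * d k) l m * jetChristoffel I d m i j =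
      ∑ m, (I * d k * I) l m * firstKind d i j m := by
    simp only [jetChristoffel_eq, Matrix.mul_apply (M := I * d k), Finset.mul_sum, Finset.sum_mul]
    rw [Finset.sum_comm]
    exact Finset.sum_congr rfl fun m _ => Finset.sum_congr rfl fun a _ => by ring
  rw [h2, ← Finset.sum_sub_distrib, jetDChristoffel, Finset.mul_sum]
  exact Finset.sum_congr rfl fun m _ => by simp only [firstKind]; ring

/-- The scalar curvature in terms of the Christoffel symbols of the first kind. -/
theorem jetScalar_eq {n : ℕ} (I : Matrix (Fin n) (Fin n) ℝ)
    {d : Fin n → Matrix (Fin n) (Fin n) ℝ} (dd : Fin n → Fin n → Matrix (Fin n) (Fin n) ℝ)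
    (hd : ∀ k i j, d k i j = d k j i) :
    jetScalar I d dd = ∑ i, ∑ j, I i j *
      (∑ l, ∑ m, I l m * (firstKind (dd l) i j m - firstKind (dd j) i l m)
        + ∑ m, (∑ l, (∑ a, I l a * firstKind d j a m) * jetChristoffel I d m i l
          - (∑ l, ∑ a, I l a * firstKind d l a m) * jetChristoffel I d m i j)) := by
  have hs : ∀ l i j, jetChristoffel I d l i j = jetChristoffel I d l j i := fun l i j => by
    simp only [jetChristoffel_eq, firstKind_symm hd i j]
  refine Finset.sum_congr rfl fun i _ => Finset.sum_congr rfl fun j _ => ?_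
  congr 1
  simp only [jetDChristoffel_eq I dd hd, Finset.sum_add_distrib, Finset.sum_sub_distrib, mul_sub,
    add_mul, Finset.sum_mul]
  -- Both quadratic terms of the Ricci tensor cancel against the `Γ^l_{km}` parts produced by
  -- `jetDChristoffel_eq`; `h1` and `h2` match them up.
  have h1 : ∑ l, ∑ m, jetChristoffel I d l i j * jetChristoffel I d m l m =
      ∑ l, ∑ m, jetChristoffel I d l l m * jetChristoffel I d m i j := by
    rw [Finset.sum_comm]
    exact Finset.sum_congr rfl fun m _ => Finset.sum_congr rfl fun l _ => by
      rw [hs m l m]; ring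
  have h2 : ∑ l, ∑ m, jetChristoffel I d m i l * jetChristoffel I d l j m =
      ∑ l, ∑ m, jetChristoffel I d l j m * jetChristoffel I d m i l :=
    Finset.sum_congr rfl fun m _ => Finset.sum_congr rfl fun l _ => mul_comm _ _
  have h3 : ∑ l, ∑ m, ∑ a, I l a * firstKind d l a m * jetChristoffel I d m i j =
      ∑ m, ∑ l, ∑ a, I l a * firstKind d l a m * jetChristoffel I d m i j := Finset.sum_comm
  have h4 : ∑ l, ∑ m, ∑ a, I l a * firstKind d j a m * jetChristoffel I d m i l =
      ∑ m, ∑ l, ∑ a, I l a * firstKind d j a m * jetChristoffel I d m i l := Finset.sum_comm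
  rw [h1, h2, h3, h4]
  ring

theorem sum_frame_eq {n : ℕ} {I : Matrix (Fin n) (Fin n) ℝ} {e : Fin n → ℝ}
    {f : Fin n → Fin n → ℝ} (hI : ∀ i j, I i j = ∑ a, e a * (f a i * f a j))
    (Z : Fin n → Fin n → ℝ) :
    ∑ i, ∑ j, I i j * Z i j = ∑ a, e a * ∑ i, ∑ j, f a i * (f a j * Z i j) := by
  simp only [hI, Finset.sum_mul, Finset.mul_sum]
  calc _ = ∑ i, ∑ a, ∑ j, e a * (f a i * f a j) * Z i j :=
        Finset.sum_congr rfl fun i _ => Finset.sum_comm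
    _ = ∑ a, ∑ i, ∑ j, e a * (f a i * f a j) * Z i j := Finset.sum_comm
    _ = _ := Finset.sum_congr rfl fun a _ => Finset.sum_congr rfl fun i _ =>
        Finset.sum_congr rfl fun j _ => by ring

theorem sum_frame_mul_eq {n : ℕ} {I : Matrix (Fin n) (Fin n) ℝ} {e : Fin n → ℝ}
    {f : Fin n → Fin n → ℝ} (hI : ∀ i j, I i j = ∑ a, e a * (f a i * f a j))
    (F G : Fin n → ℝ) :
    ∑ i, ∑ j, I i j * (F i * G j) = ∑ a, e a * ((∑ i, f a i * F i) * ∑ j, f a j * G j) := by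
  rw [sum_frame_eq hI]
  refine Finset.sum_congr rfl fun a _ => ?_
  rw [Finset.sum_mul_sum]
  congr 1
  exact Finset.sum_congr rfl fun i _ => Finset.sum_congr rfl fun j _ => by ring

theorem sum_sum_mul_sum {n : ℕ} (I : Matrix (Fin n) (Fin n) ℝ) (e : Fin n → ℝ)
    (Z : Fin n → Fin n → Fin n → ℝ) :
    ∑ i, ∑ j, I i j * ∑ c, e c * Z c i j = ∑ c, e c * ∑ i, ∑ j, I i j * Z c i j := by
  simp only [Finset.mul_sum]
  calc _ = ∑ i, ∑ c, ∑ j, I i j * (e c * Z c i j) :=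
        Finset.sum_congr rfl fun i _ => Finset.sum_comm
    _ = ∑ c, ∑ i, ∑ j, I i j * (e c * Z c i j) := Finset.sum_comm
    _ = _ := Finset.sum_congr rfl fun a _ => Finset.sum_congr rfl fun i _ =>
        Finset.sum_congr rfl fun j _ => by ring

/-- Each of the three contractions with `I` is diagonalized in turn, so a full contraction of two
3-index arrays becomes a weighted sum of products of frame components. -/
theorem sum_frame_mul_eq₃ {n : ℕ} {I : Matrix (Fin n) (Fin n) ℝ} {e : Fin n → ℝ}
    {f : Fin n → Fin n → ℝ} (hI : ∀ i j, I i j = ∑ a, e a * (f a i * f a j))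
    (F G : Fin n → Fin n → Fin n → ℝ) :
    ∑ i, ∑ j, I i j * ∑ l, ∑ k, I l k * ∑ m, ∑ p, I m p * (F i l m * G j k p) =
      ∑ c, e c * ∑ b, e b * ∑ a, e a *
        ((∑ i, f a i * ∑ l, f b l * ∑ m, f c m * F i l m)
          * ∑ i, f a i * ∑ l, f b l * ∑ m, f c m * G i l m) := by
  simp only [sum_frame_mul_eq hI, sum_sum_mul_sum]

/-- The Christoffel symbols of the first kind in the frame `f`. -/
def frameFirstKind {n : ℕ} (f : Fin n → Fin n → ℝ) (d : Fin n → Matrix (Fin n) (Fin n) ℝ)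
    (a b c : Fin n) : ℝ :=
  ∑ i, f a i * ∑ j, f b j * ∑ m, f c m * firstKind d i j m

/-- The part of the curvature tensor in the frame `f` that is linear in the second derivatives of
the metric. -/
def frameSecond {n : ℕ} (f : Fin n → Fin n → ℝ)
    (dd : Fin n → Fin n → Matrix (Fin n) (Fin n) ℝ) (a b : Fin n) : ℝ :=
  ∑ i, ∑ j, f a i * (f a j * ∑ l, ∑ m, f b l * (f b m *
    (firstKind (dd l) i j m - firstKind (dd j) i l m)))

/-- The scalar curvature in a frame that diagonalizes the inverse metric. -/
theorem jetScalar_eq_frame {n : ℕ} {I : Matrix (Fin n) (Fin n) ℝ} {e : Fin n → ℝ}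
    {f : Fin n → Fin n → ℝ} (hI : ∀ i j, I i j = ∑ a, e a * (f a i * f a j))
    {d : Fin n → Matrix (Fin n) (Fin n) ℝ} (dd : Fin n → Fin n → Matrix (Fin n) (Fin n) ℝ)
    (hd : ∀ k i j, d k i j = d k j i) :
    jetScalar I d dd = ∑ a, e a * ∑ b, e b * frameSecond f dd a b
      + ∑ c, e c * (∑ b, e b * ∑ a, e a * frameFirstKind f d a b c ^ 2
        - (∑ a, e a * frameFirstKind f d a a c) ^ 2) := by
  have hsymm : ∀ i j, I i j = I j i := fun i j => by simp only [hI, mul_comm (f _ i)]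
  have h1 : ∑ i, ∑ j, I i j * ∑ l, ∑ m, I l m *
      (firstKind (dd l) i j m - firstKind (dd j) i l m) =
      ∑ a, e a * ∑ b, e b * frameSecond f dd a b := by
    simp only [sum_frame_eq hI, frameSecond]
    refine Finset.sum_congr rfl fun a _ => ?_
    congr 1
    simp only [Finset.mul_sum]
    calc _ = ∑ i, ∑ b, ∑ j, ∑ l, ∑ m, f a i * (f a j * (e b * (f b l * (f b m *
            (firstKind (dd l) i j m - firstKind (dd j) i l m))))) :=
          Finset.sum_congr rfl fun i _ => Finset.sum_comm
      _ = _ := by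
          rw [Finset.sum_comm]
          exact Finset.sum_congr rfl fun b _ => Finset.sum_congr rfl fun i _ =>
            Finset.sum_congr rfl fun j _ => Finset.sum_congr rfl fun l _ =>
            Finset.sum_congr rfl fun m _ => by ring
  have h2 : ∑ i, ∑ j, I i j * ∑ m, ∑ l, (∑ a, I l a * firstKind d j a m)
        * jetChristoffel I d m i l =
      ∑ c, e c * ∑ b, e b * ∑ a, e a * frameFirstKind f d a b c ^ 2 := by
    have h := sum_frame_mul_eq₃ hI (firstKind d) (firstKind d)
    simp only [← sq] at h
    simp only [frameFirstKind]
    rw [← h]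
    refine Finset.sum_congr rfl fun i _ => Finset.sum_congr rfl fun j _ => ?_
    congr 1
    rw [Finset.sum_comm]
    refine Finset.sum_congr rfl fun l _ => ?_
    simp only [jetChristoffel_eq, Finset.sum_mul, Finset.mul_sum]
    rw [Finset.sum_comm]
    refine (Finset.sum_congr rfl fun k _ => Finset.sum_comm).trans ?_
    rw [Finset.sum_comm]
    refine Finset.sum_congr rfl fun k _ => Finset.sum_congr rfl fun p _ =>
      Finset.sum_congr rfl fun m _ => ?_
    rw [hsymm m p]
    ring
  -- The other quadratic term is the squared length of the single covector `I^{ij} Γ_{ij,m}`; `h5`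
  -- computes its frame components.
  have h3 : ∑ i, ∑ j, I i j * ∑ m, (∑ l, ∑ a, I l a * firstKind d l a m)
        * jetChristoffel I d m i j =
      ∑ c, e c * (∑ a, e a * frameFirstKind f d a a c) ^ 2 := by
    have h4 : ∀ m, ∑ l, ∑ a, I l a * firstKind d l a m =
        ∑ b, e b * ∑ i, ∑ j, f b i * (f b j * firstKind d i j m) := fun m =>
      sum_frame_eq hI fun l a => firstKind d l a m
    have h5 : ∀ c, ∑ a, e a * frameFirstKind f d a a c =
        ∑ m, f c m * ∑ i, ∑ j, I i j * firstKind d i j m := by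
      intro c
      simp only [h4, frameFirstKind, Finset.mul_sum]
      symm
      rw [Finset.sum_comm]
      refine Finset.sum_congr rfl fun a _ => ?_
      rw [Finset.sum_comm]
      refine Finset.sum_congr rfl fun i _ => ?_
      rw [Finset.sum_comm]
      exact Finset.sum_congr rfl fun j _ => Finset.sum_congr rfl fun m _ => by ring
    have h7 : ∀ Y : Fin n → ℝ, ∑ i, ∑ j, I i j * ∑ m, Y m * jetChristoffel I d m i j =
        ∑ m, ∑ p, I m p * (Y m * ∑ i, ∑ j, I i j * firstKind d i j p) := by
      intro Y
      simp only [jetChristoffel_eq, Finset.mul_sum]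
      refine (Finset.sum_congr rfl fun i _ => Finset.sum_comm).trans ?_
      rw [Finset.sum_comm]
      refine Finset.sum_congr rfl fun m _ => ?_
      refine (Finset.sum_congr rfl fun i _ => Finset.sum_comm).trans ?_
      rw [Finset.sum_comm]
      exact Finset.sum_congr rfl fun p _ => Finset.sum_congr rfl fun i _ =>
        Finset.sum_congr rfl fun j _ => by ring
    have h6 := sum_frame_mul_eq hI (fun m => ∑ i, ∑ j, I i j * firstKind d i j m)
      (fun m => ∑ i, ∑ j, I i j * firstKind d i j m)
    simp only [h5, sq]
    rw [← h6, h7]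
  rw [jetScalar_eq I dd hd, ← h1, Finset.sum_congr rfl fun c _ => mul_sub (e c) _ _,
    Finset.sum_sub_distrib, ← h2, ← h3]
  simp only [Finset.sum_sub_distrib, mul_add, mul_sub, Finset.sum_add_distrib]

/-! ### Explicit curvature in the adapted frame -/

theorem symm₃_00 (a P Q E G : ℝ) : symm₃ a P Q E G 0 0 = a := rfl
theorem symm₃_01 (a P Q E G : ℝ) : symm₃ a P Q E G 0 1 = P := rfl
theorem symm₃_02 (a P Q E G : ℝ) : symm₃ a P Q E G 0 2 = Q := rfl
theorem symm₃_10 (a P Q E G : ℝ) : symm₃ a P Q E G 1 0 = P := rfl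
theorem symm₃_11 (a P Q E G : ℝ) : symm₃ a P Q E G 1 1 = E := rfl
theorem symm₃_12 (a P Q E G : ℝ) : symm₃ a P Q E G 1 2 = 0 := rfl
theorem symm₃_20 (a P Q E G : ℝ) : symm₃ a P Q E G 2 0 = Q := rfl
theorem symm₃_21 (a P Q E G : ℝ) : symm₃ a P Q E G 2 1 = 0 := rfl
theorem symm₃_22 (a P Q E G : ℝ) : symm₃ a P Q E G 2 2 = G := rfl

/-- A frame that diagonalizes the inverse of a metric `symm₃ a P Q E G`. -/
def adaptedFrame (p q u : ℝ) : Fin 3 → Fin 3 → ℝ := ![![1, -p, -q], ![0, u, 0], ![0, 0, 1]]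
theorem adaptedFrame_00 (p q u : ℝ) : adaptedFrame p q u 0 0 = 1 := rfl
theorem adaptedFrame_01 (p q u : ℝ) : adaptedFrame p q u 0 1 = -p := rfl
theorem adaptedFrame_02 (p q u : ℝ) : adaptedFrame p q u 0 2 = -q := rfl
theorem adaptedFrame_10 (p q u : ℝ) : adaptedFrame p q u 1 0 = 0 := rfl
theorem adaptedFrame_11 (p q u : ℝ) : adaptedFrame p q u 1 1 = u := rfl
theorem adaptedFrame_12 (p q u : ℝ) : adaptedFrame p q u 1 2 = 0 := rfl
theorem adaptedFrame_20 (p q u : ℝ) : adaptedFrame p q u 2 0 = 0 := rfl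
theorem adaptedFrame_21 (p q u : ℝ) : adaptedFrame p q u 2 1 = 0 := rfl
theorem adaptedFrame_22 (p q u : ℝ) : adaptedFrame p q u 2 2 = 1 := rfl

section

variable {p q u : ℝ} {d : Fin 3 → Matrix (Fin 3) (Fin 3) ℝ}
  {aθ aφ Pt Pθ Pφ Qt Qθ Et Eφ Gt : ℝ}

/-- The zero entries in the hypotheses are those that `kinMetricD` has at `t = 0`. Tabulating the
components keeps the later expansion of the curvature small. -/
theorem frameFirstKind_adaptedFrame
    (h0 : d 0 = symm₃ 0 Pt Qt Et Gt) (h1 : d 1 = symm₃ aθ Pθ Qθ 0 0)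
    (h2 : d 2 = symm₃ aφ Pφ 0 Eφ 0) (a b c : Fin 3) :
    frameFirstKind (adaptedFrame p q u) d a b c =
      ![![![p * q * (Qθ + Pφ) - p * Pt - p * aθ / 2 - p ^ 2 * q * Eφ / 2 + p ^ 2 * Pθ + p ^ 2 * Et / 2
        - q * Qt - q * aφ / 2 + q ^ 2 * Gt / 2,
        u * (Pt - aθ / 2 - p * Et + p * q * Eφ - q * Pφ + q * Qθ),
        Qt - aφ / 2 - p * Qθ + p * Pφ - p ^ 2 * Eφ / 2 - q * Gt],
      ![u * (aθ / 2 - p * Pθ - q * Qθ), u ^ 2 * (Et - q * Eφ) / 2, u * (Qθ - Pφ + p * Eφ) / 2],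
      ![aφ / 2 - p * Pφ + p ^ 2 * Eφ / 2, u * (Pφ - Qθ - p * Eφ) / 2, Gt / 2]],
      ![![u * (aθ / 2 - p * Pθ - q * Qθ), u ^ 2 * (Et - q * Eφ) / 2, u * (Qθ - Pφ + p * Eφ) / 2],
      ![u ^ 2 * (Pθ - Et / 2 + q * Eφ / 2), 0, -(u ^ 2 * Eφ / 2)],
      ![u * (Pφ + Qθ - p * Eφ) / 2, u ^ 2 * Eφ / 2, 0]],
      ![![aφ / 2 - p * Pφ + p ^ 2 * Eφ / 2, u * (Pφ - Qθ - p * Eφ) / 2, Gt / 2],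
      ![u * (Pφ + Qθ - p * Eφ) / 2, u ^ 2 * Eφ / 2, 0],
      ![-(Gt / 2), 0, 0]]] a b c := by
  fin_cases a <;> fin_cases b <;> fin_cases c <;>
  · simp only [Fin.zero_eta, Fin.mk_one, Fin.reduceFinMk, frameFirstKind, firstKind,
      Fin.sum_univ_three, h0, h1, h2, symm₃_00, symm₃_01, symm₃_02, symm₃_10, symm₃_11, symm₃_12,
        symm₃_20, symm₃_21, symm₃_22, adaptedFrame_00, adaptedFrame_01, adaptedFrame_02,
        adaptedFrame_10, adaptedFrame_11, adaptedFrame_12, adaptedFrame_20, adaptedFrame_21,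
        adaptedFrame_22, zero_mul, zero_add, add_zero, one_mul, Matrix.cons_val]
    ring

variable {dd : Fin 3 → Fin 3 → Matrix (Fin 3) (Fin 3) ℝ}
  {e E Ptθ Ptφ Qtφ Etφ aθθ aθφ aφφ Pθθ Pθφ Pφφ Qθθ Eφφ : ℝ}

/-- Besides the zeros at `t = 0`, the mixed derivative `∂ₜ∂_θ` of the entry `Q` is taken to be zero:
it is a multiple of `tangential m₁ m₂ θ * sin φ`, which vanishes on the equator and also when `m₁ =
m₂ = 0`. -/
theorem frameSecond_adaptedFrame
    (h00 : dd 0 0 = symm₃ 0 0 0 E e) (h01 : dd 0 1 = symm₃ 0 Ptθ 0 0 0)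
    (h02 : dd 0 2 = symm₃ 0 Ptφ Qtφ Etφ 0) (h11 : dd 1 1 = symm₃ aθθ Pθθ Qθθ 0 0)
    (h12 : dd 1 2 = symm₃ aθφ Pθφ 0 0 0) (h22 : dd 2 2 = symm₃ aφφ Pφφ 0 Eφφ 0)
    (h10 : dd 1 0 = dd 0 1) (h20 : dd 2 0 = dd 0 2) (h21 : dd 2 1 = dd 1 2) (a b : Fin 3) :
    frameSecond (adaptedFrame p q u) dd a b =
      !![0, u ^ 2 * (Ptθ - aθθ / 2 - E / 2 - q * Pθφ + q * Qθθ + q * Etφ - q ^ 2 * Eφφ / 2),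
          Qtφ - aφφ / 2 - e / 2 + p * Pφφ - p ^ 2 * Eφφ / 2;
        u ^ 2 * (Ptθ - aθθ / 2 - E / 2 - q * Pθφ + q * Qθθ + q * Etφ - q ^ 2 * Eφφ / 2), 0,
          -(u ^ 2 * Eφφ / 2);
        Qtφ - aφφ / 2 - e / 2 + p * Pφφ - p ^ 2 * Eφφ / 2, -(u ^ 2 * Eφφ / 2), 0] a b := by
  fin_cases a <;> fin_cases b <;>
  · simp only [Fin.zero_eta, Fin.mk_one, Fin.reduceFinMk, frameSecond, firstKind,
      Fin.sum_univ_three, h10, h20, h21, h00, h01, h02, h11, h12, h22, symm₃_00, symm₃_01, symm₃_02, symm₃_10, symm₃_11, symm₃_12,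
        symm₃_20, symm₃_21, symm₃_22, adaptedFrame_00, adaptedFrame_01, adaptedFrame_02,
        adaptedFrame_10, adaptedFrame_11, adaptedFrame_12, adaptedFrame_20, adaptedFrame_21,
        adaptedFrame_22, zero_mul, zero_add, add_zero, mul_zero, one_mul,
      Matrix.of_apply, Matrix.cons_val]
    ring

end

theorem det_symm₃ (a P Q E G : ℝ) :
    (symm₃ a P Q E G).det = a * E * G - P ^ 2 * G - Q ^ 2 * E := by
  simp [symm₃, Matrix.det_fin_three]
  ring

/-- The first frame vector is `∂ₜ - p ∂_θ - q ∂_φ`, orthogonal to the slice and of squared length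
`D`; the other two are orthonormal and tangent to the slice. -/
theorem symm₃_inv_apply {a P Q E D p q u : ℝ} (hD : D ≠ 0) (hE : u ^ 2 * E = 1)
    (hP : P = p * E) (hQ : Q = q) (ha : a = D + p ^ 2 * E + q ^ 2) (i j : Fin 3) :
    (symm₃ a P Q E 1)⁻¹ i j =
      ∑ b, ![D⁻¹, 1, 1] b * (adaptedFrame p q u b i * adaptedFrame p q u b j) := by
  have h : symm₃ a P Q E 1 * Matrix.of (fun i j =>
      ∑ b, ![D⁻¹, 1, 1] b * (adaptedFrame p q u b i * adaptedFrame p q u b j)) = 1 := by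
    subst hP hQ ha
    ext i j
    fin_cases i <;> fin_cases j <;>
      simp [Matrix.mul_apply, Fin.sum_univ_three, symm₃, adaptedFrame] <;> field_simp <;>
      first | ring1 | linear_combination D * hE | linear_combination p * D * hE
  rw [Matrix.inv_eq_right_inv h]
  rfl

/-- The scalar curvature of `kinMetric` along the equator `φ = 0` at `t = 0`. -/
theorem jetScalar_equator {D l s r τ c₃ mr mt m₃ : ℝ} (hD : D ≠ 0)
    {I : Matrix (Fin 3) (Fin 3) ℝ}
    (hI : ∀ i j, I i j =
      ∑ b, ![D⁻¹, 1, 1] b * (adaptedFrame c₃ (-τ) 1 b i * adaptedFrame c₃ (-τ) 1 b j))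
    {d : Fin 3 → Matrix (Fin 3) (Fin 3) ℝ} {dd : Fin 3 → Fin 3 → Matrix (Fin 3) (Fin 3) ℝ}
    (hd : ∀ k i j, d k i j = d k j i)
    (h0 : d 0 = symm₃ 0 mt m₃ (2 * s) (2 * s)) (h1 : d 1 = symm₃ (2 * mt) 0 r 0 0)
    (h2 : d 2 = symm₃ (2 * m₃) (-r) 0 0 0)
    (h00 : dd 0 0 = symm₃ 0 0 0 (2 * s ^ 2 + 2 * l) (2 * s ^ 2 + 2 * l))
    (h01 : dd 0 1 = symm₃ 0 (-mr) 0 0 0) (h02 : dd 0 2 = symm₃ 0 0 (-mr) 0 0)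
    (h11 : dd 1 1 = symm₃ (-2 * mr) 0 τ 0 0) (h12 : dd 1 2 = symm₃ 0 (-τ) 0 0 0)
    (h22 : dd 2 2 = symm₃ (-2 * mr) (-2 * c₃) 0 (-2) 0)
    (h10 : dd 1 0 = dd 0 1) (h20 : dd 2 0 = dd 0 2) (h21 : dd 2 1 = dd 1 2) :
    jetScalar I d dd * D ^ 2 =
      2 * D ^ 2 - D * (2 * s ^ 2 + 4 * l + 2 * (r ^ 2 + τ ^ 2 + c₃ ^ 2) - 6 * r ^ 2)
      + 2 * (mt ^ 2 + m₃ ^ 2) + 4 * r * (mt * τ + m₃ * c₃)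
      + (2 * r ^ 2 + 4 * s ^ 2) * (τ ^ 2 + c₃ ^ 2) - 8 * s * (c₃ * mt - τ * m₃) := by
  rw [jetScalar_eq_frame hI dd hd]
  simp only [Fin.sum_univ_three, frameFirstKind_adaptedFrame h0 h1 h2,
    frameSecond_adaptedFrame h00 h01 h02 h11 h12 h22 h10 h20 h21, Matrix.cons_val,
    Matrix.of_apply]
  field_simp
  ring

/-- The scalar curvature of a rotationally symmetric `kinMetric` at `t = 0`. -/
theorem jetScalar_axial {D l s c₃ m₃ C S : ℝ} (hD : D ≠ 0) (hC : C ≠ 0) (hCS : S ^ 2 + C ^ 2 = 1)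
    {I : Matrix (Fin 3) (Fin 3) ℝ}
    (hI : ∀ i j, I i j =
      ∑ b, ![D⁻¹, 1, 1] b * (adaptedFrame c₃ 0 C⁻¹ b i * adaptedFrame c₃ 0 C⁻¹ b j))
    {d : Fin 3 → Matrix (Fin 3) (Fin 3) ℝ} {dd : Fin 3 → Fin 3 → Matrix (Fin 3) (Fin 3) ℝ}
    (hd : ∀ k i j, d k i j = d k j i)
    (h0 : d 0 = symm₃ 0 0 (m₃ * C) (2 * s * C ^ 2) (2 * s)) (h1 : d 1 = symm₃ 0 0 0 0 0)
    (h2 : d 2 = symm₃ (2 * (m₃ * C)) (-2 * c₃ * C * S) 0 (-2 * C * S) 0)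
    (h00 : dd 0 0 = symm₃ 0 0 0 ((2 * s ^ 2 + 2 * l) * C ^ 2) (2 * s ^ 2 + 2 * l))
    (h01 : dd 0 1 = symm₃ 0 0 0 0 0)
    (h02 : dd 0 2 = symm₃ 0 0 (-(m₃ * S)) (-2 * (2 * s) * C * S) 0)
    (h11 : dd 1 1 = symm₃ 0 0 0 0 0) (h12 : dd 1 2 = symm₃ 0 0 0 0 0)
    (h22 : dd 2 2 = symm₃ (2 * (-(m₃ * S))) (-2 * c₃ * (C ^ 2 - S ^ 2)) 0
      (-2 * (C ^ 2 - S ^ 2)) 0)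
    (h10 : dd 1 0 = dd 0 1) (h20 : dd 2 0 = dd 0 2) (h21 : dd 2 1 = dd 1 2) :
    jetScalar I d dd * D ^ 2 =
      2 * D ^ 2 - D * (2 * s ^ 2 + 4 * l + 2 * c₃ ^ 2 - 6 * (c₃ * S) ^ 2)
      + (1 - S ^ 2) * (2 * m₃ ^ 2 + 4 * c₃ ^ 2 * m₃ * S + 2 * c₃ ^ 4 * S ^ 2
        + 4 * s ^ 2 * c₃ ^ 2) := by
  rw [jetScalar_eq_frame hI dd hd]
  simp only [Fin.sum_univ_three, frameFirstKind_adaptedFrame h0 h1 h2,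
    frameSecond_adaptedFrame h00 h01 h02 h11 h12 h22 h10 h20 h21, Matrix.cons_val,
    Matrix.of_apply]
  field_simp
  linear_combination (8 * D * C ^ 4 * (2 * s ^ 2 * c₃ ^ 2 + 2 * S * m₃ * c₃ ^ 2 + S ^ 2 * c₃ ^ 4
    + m₃ ^ 2) - 8 * D ^ 2 * C ^ 4 * c₃ ^ 2) * hCS

/-! ### Curvature identities on the equator and along a meridian -/

theorem kinMetricD_symm (l s c₁ c₂ c₃ m₁ m₂ m₃ : ℝ) (p : Fin 3 → ℝ) (k i j : Fin 3) :
    kinMetricD l s c₁ c₂ c₃ m₁ m₂ m₃ p k i j = kinMetricD l s c₁ c₂ c₃ m₁ m₂ m₃ p k j i := by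
  fin_cases k <;> fin_cases i <;> fin_cases j <;> rfl

theorem scalarCurvature_eq_jetScalar_kinMetric {k l s c₁ c₂ c₃ m₁ m₂ m₃ : ℝ}
    {X : (Fin 3 → ℝ) → E7} (hX : ∀ q, metric X q = kinMetric k l s c₁ c₂ c₃ m₁ m₂ m₃ q)
    {p : Fin 3 → ℝ} (hp : (metric X p).det ≠ 0) :
    scalarCurvature X p = jetScalar (metric X p)⁻¹ (kinMetricD l s c₁ c₂ c₃ m₁ m₂ m₃ p)
      (kinMetricDD l s c₁ c₂ c₃ m₁ m₂ m₃ p) := by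
  rw [hX] at hp ⊢
  exact scalarCurvature_eq_jetScalar X _
    (fun k q => kinMetricD l s c₁ c₂ c₃ m₁ m₂ m₃ q k) _ p hX
    (fun q a i j => hasDerivAt_kinMetric k l s c₁ c₂ c₃ m₁ m₂ m₃ q a i j)
    (fun a b i j => hasDerivAt_kinMetricD l s c₁ c₂ c₃ m₁ m₂ m₃ p a b i j) hp

theorem metric_equator {k l s c₁ c₂ c₃ m₁ m₂ m₃ : ℝ}
    {X : (Fin 3 → ℝ) → E7} (hX : ∀ q, metric X q = kinMetric k l s c₁ c₂ c₃ m₁ m₂ m₃ q) (θ : ℝ) :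
    metric X ![0, θ, 0] =
      symm₃ (k + 2 * radial m₁ m₂ θ) c₃ (-tangential c₁ c₂ θ) 1 1 := by
  rw [hX]
  simp [kinMetric, radiusSq]

/-- Here `D` is the determinant of the metric. The extra factor `D` makes the identity valid at
degenerate points too, so it holds for all `θ`. -/
theorem equator_identity {k l s c₁ c₂ c₃ m₁ m₂ m₃ : ℝ}
    {X : (Fin 3 → ℝ) → E7} (hX : ∀ q, metric X q = kinMetric k l s c₁ c₂ c₃ m₁ m₂ m₃ q)
    (hK : ∀ θ φ : ℝ, (metric X ![0, θ, φ]).det ≠ 0 → scalarCurvature X ![0, θ, φ] = 0)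
    {θ r τ mr mt D : ℝ} (hr : r = radial c₁ c₂ θ) (hτ : τ = tangential c₁ c₂ θ)
    (hmr : mr = radial m₁ m₂ θ) (hmt : mt = tangential m₁ m₂ θ)
    (hD : D = k + 2 * mr - c₃ ^ 2 - τ ^ 2) :
    D * (2 * D ^ 2 - D * (2 * s ^ 2 + 4 * l + 2 * (r ^ 2 + τ ^ 2 + c₃ ^ 2) - 6 * r ^ 2)
      + 2 * (mt ^ 2 + m₃ ^ 2) + 4 * r * (mt * τ + m₃ * c₃)
      + (2 * r ^ 2 + 4 * s ^ 2) * (τ ^ 2 + c₃ ^ 2) - 8 * s * (c₃ * mt - τ * m₃)) = 0 := by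
  rcases eq_or_ne D 0 with h | h
  · simp [h]
  have hg : metric X ![0, θ, 0] = symm₃ (k + 2 * mr) c₃ (-τ) 1 1 := by
    rw [metric_equator hX, hmr, hτ]
  have hdet : (metric X ![0, θ, 0]).det ≠ 0 := by
    rw [hg, det_symm₃]
    convert h using 1
    rw [hD]
    ring
  have h0 := hK θ 0 hdet
  rw [scalarCurvature_eq_jetScalar_kinMetric hX hdet, hg] at h0
  have hI := symm₃_inv_apply (a := k + 2 * mr) (P := c₃) (Q := -τ) (E := 1) (p := c₃) (q := -τ)
    (u := 1) h (by norm_num) (by ring) rfl (by rw [hD]; ring)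
  rw [← jetScalar_equator (mr := mr) h hI (kinMetricD_symm l s c₁ c₂ c₃ m₁ m₂ m₃ ![0, θ, 0])
    (dd := kinMetricDD l s c₁ c₂ c₃ m₁ m₂ m₃ ![0, θ, 0]), h0]
  · simp
  all_goals subst hr hτ hmr hmt
  all_goals simp [kinMetricD, kinMetricDD, radiusSq, radiusSqDeriv]

theorem metric_axial {k l s c₃ m₃ : ℝ}
    {X : (Fin 3 → ℝ) → E7} (hX : ∀ q, metric X q = kinMetric k l s 0 0 c₃ 0 0 m₃ q) (φ : ℝ) :
    metric X ![0, 0, φ] = symm₃ (k + 2 * (m₃ * Real.sin φ)) (c₃ * Real.cos φ ^ 2) 0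
      (Real.cos φ ^ 2) 1 := by
  rw [hX]
  simp [kinMetric, radiusSq, radial, tangential]
  ring_nf

/-- The determinant is `D cos² φ`; the poles `cos φ = 0` are excluded because the coordinates
degenerate there. -/
theorem axial_identity {k l s c₃ m₃ : ℝ}
    {X : (Fin 3 → ℝ) → E7} (hX : ∀ q, metric X q = kinMetric k l s 0 0 c₃ 0 0 m₃ q)
    (hK : ∀ θ φ : ℝ, (metric X ![0, θ, φ]).det ≠ 0 → scalarCurvature X ![0, θ, φ] = 0)
    {φ S D : ℝ} (hS : S = Real.sin φ) (hC : Real.cos φ ≠ 0)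
    (hD : D = k + 2 * m₃ * S - c₃ ^ 2 * (1 - S ^ 2)) :
    D * (2 * D ^ 2 - D * (2 * s ^ 2 + 4 * l + 2 * c₃ ^ 2 - 6 * (c₃ * S) ^ 2)
      + (1 - S ^ 2) * (2 * m₃ ^ 2 + 4 * c₃ ^ 2 * m₃ * S + 2 * c₃ ^ 4 * S ^ 2
        + 4 * s ^ 2 * c₃ ^ 2)) = 0 := by
  rcases eq_or_ne D 0 with h | h
  · simp [h]
  have hCS : S ^ 2 + Real.cos φ ^ 2 = 1 := hS ▸ Real.sin_sq_add_cos_sq φ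
  have hD' : D = k + 2 * (m₃ * S) - c₃ ^ 2 * Real.cos φ ^ 2 := by
    rw [hD]
    linear_combination c₃ ^ 2 * hCS
  have hg : metric X ![0, 0, φ] = symm₃ (k + 2 * (m₃ * S)) (c₃ * Real.cos φ ^ 2) 0
      (Real.cos φ ^ 2) 1 := by
    rw [metric_axial hX, hS]
  have hdet : (metric X ![0, 0, φ]).det ≠ 0 := by
    rw [hg, det_symm₃]
    convert mul_ne_zero h (pow_ne_zero 2 hC) using 1
    rw [hD']
    ring
  have h0 := hK 0 φ hdet
  rw [scalarCurvature_eq_jetScalar_kinMetric hX hdet, hg] at h0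
  have hI := symm₃_inv_apply (a := k + 2 * (m₃ * S)) (P := c₃ * Real.cos φ ^ 2) (Q := 0)
    (E := Real.cos φ ^ 2) (p := c₃) (q := 0) (u := (Real.cos φ)⁻¹) h
    (by field_simp) rfl rfl (by rw [hD']; ring)
  rw [← jetScalar_axial h hC hCS hI (kinMetricD_symm l s 0 0 c₃ 0 0 m₃ ![0, 0, φ])
    (dd := kinMetricDD l s 0 0 c₃ 0 0 m₃ ![0, 0, φ]), h0]
  · simp
  all_goals subst hS
  all_goals simp [kinMetricD, kinMetricDD, radiusSq, radiusSqDeriv, radial, tangential]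

/-! ### Extraction of leading coefficients -/

section

open Polynomial

theorem cos_two_mul_arctan (u : ℝ) :
    Real.cos (2 * Real.arctan u) = (1 - u ^ 2) / (1 + u ^ 2) := by
  have h : (1 + u ^ 2) ≠ 0 := by positivity
  rw [Real.cos_two_mul, Real.cos_sq_arctan]
  field_simp
  ring

theorem sin_two_mul_arctan (u : ℝ) :
    Real.sin (2 * Real.arctan u) = 2 * u / (1 + u ^ 2) := by
  have h : (1 + u ^ 2) ≠ 0 := by positivity
  have h1 : Real.sqrt (1 + u ^ 2) ^ 2 = 1 + u ^ 2 := Real.sq_sqrt (by positivity)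
  have h2 : Real.sqrt (1 + u ^ 2) ≠ 0 := by positivity
  rw [Real.sin_two_mul, Real.sin_arctan, Real.cos_arctan]
  field_simp
  rw [h1]

theorem radial_two_mul_arctan (a b u : ℝ) : radial a b (2 * Real.arctan u) =
    (a * (1 - u ^ 2) + b * (2 * u)) / (1 + u ^ 2) := by
  rw [radial, cos_two_mul_arctan, sin_two_mul_arctan]
  ring

theorem tangential_two_mul_arctan (a b u : ℝ) : tangential a b (2 * Real.arctan u) =
    (-a * (2 * u) + b * (1 - u ^ 2)) / (1 + u ^ 2) := by
  rw [tangential, cos_two_mul_arctan, sin_two_mul_arctan]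
  ring

/-- A real polynomial that vanishes on `ℝ` vanishes at the imaginary unit. -/
theorem aeval_I_eq_zero {P : Polynomial ℝ} (h : ∀ u : ℝ, P.eval u = 0) :
    Polynomial.aeval Complex.I P = 0 := by
  have : P = 0 := Polynomial.funext fun u => by simpa using h u
  rw [this, map_zero]

theorem eq_zero_of_add_mul_I {a b : ℝ} (h : (a : ℂ) + b * Complex.I = 0) : a = 0 ∧ b = 0 := by
  constructor
  · simpa using congrArg Complex.re h
  · simpa using congrArg Complex.im h

/-- With `u = tan (θ / 2)` the identity becomes a polynomial in `u` after clearing powers of `w = 1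
+ u²`. At `u = i` we have `w = 0`, so only the terms of top trigonometric degree survive, leaving
`384 (c₁ + i c₂)⁶`. -/
theorem rotation_eq_zero_of_equator {k l s c₁ c₂ c₃ m₁ m₂ m₃ : ℝ}
    (h : ∀ θ r τ mr mt D : ℝ, r = radial c₁ c₂ θ → τ = tangential c₁ c₂ θ →
      mr = radial m₁ m₂ θ → mt = tangential m₁ m₂ θ → D = k + 2 * mr - c₃ ^ 2 - τ ^ 2 →
      D * (2 * D ^ 2 - D * (2 * s ^ 2 + 4 * l + 2 * (r ^ 2 + τ ^ 2 + c₃ ^ 2) - 6 * r ^ 2)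
      + 2 * (mt ^ 2 + m₃ ^ 2) + 4 * r * (mt * τ + m₃ * c₃)
      + (2 * r ^ 2 + 4 * s ^ 2) * (τ ^ 2 + c₃ ^ 2) - 8 * s * (c₃ * mt - τ * m₃)) = 0) :
    c₁ = 0 ∧ c₂ = 0 := by
  let w : ℝ[X] := 1 + X ^ 2
  let R : ℝ[X] := C c₁ * (1 - X ^ 2) + C c₂ * (2 * X)
  let T : ℝ[X] := -C c₁ * (2 * X) + C c₂ * (1 - X ^ 2)
  let Mr : ℝ[X] := C m₁ * (1 - X ^ 2) + C m₂ * (2 * X)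
  let Mt : ℝ[X] := -C m₁ * (2 * X) + C m₂ * (1 - X ^ 2)
  let D : ℝ[X] := C k * w ^ 2 + 2 * Mr * w - C c₃ ^ 2 * w ^ 2 - T ^ 2
  let P : ℝ[X] := D * (2 * D ^ 2 - D * ((2 * C s ^ 2 + 4 * C l) * w ^ 2
      + 2 * (R ^ 2 + T ^ 2 + C c₃ ^ 2 * w ^ 2) - 6 * R ^ 2)
      + 2 * (Mt ^ 2 + C m₃ ^ 2 * w ^ 2) * w ^ 2 + 4 * R * (Mt * T + C m₃ * C c₃ * w ^ 2) * w
      + (2 * R ^ 2 + 4 * C s ^ 2 * w ^ 2) * (T ^ 2 + C c₃ ^ 2 * w ^ 2)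
      - 8 * C s * (C c₃ * Mt - T * C m₃) * w ^ 3)
  have hP : ∀ u : ℝ, P.eval u = 0 := by
    intro u
    have hw : (1 + u ^ 2) ≠ 0 := by positivity
    have h1 := h (2 * Real.arctan u) _ _ _ _ _ rfl rfl rfl rfl rfl
    simp only [radial_two_mul_arctan, tangential_two_mul_arctan] at h1
    -- `D` has trigonometric degree 2 and the bracket degree 4, hence the exponent 6.
    have h2 : P.eval u = (1 + u ^ 2) ^ 6 * 0 := by
      rw [← h1]
      simp only [P, D, R, T, Mr, Mt, w, eval_add, eval_sub, eval_mul, eval_pow, eval_neg, eval_C,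
        eval_X, eval_one, eval_ofNat]
      generalize c₁ * (1 - u ^ 2) + c₂ * (2 * u) = R
      generalize -c₁ * (2 * u) + c₂ * (1 - u ^ 2) = T
      generalize m₁ * (1 - u ^ 2) + m₂ * (2 * u) = Mr
      generalize -m₁ * (2 * u) + m₂ * (1 - u ^ 2) = Mt
      generalize 1 + u ^ 2 = w at hw
      field_simp
    simpa using h2
  have hI := aeval_I_eq_zero hP
  simp only [P, D, R, T, Mr, Mt, w, map_add, map_sub, map_mul, map_pow, map_neg, aeval_C,
    aeval_X, map_one, map_ofNat, Complex.coe_algebraMap, Complex.I_sq] at hI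
  refine eq_zero_of_add_mul_I (pow_eq_zero_iff (n := 6) (by norm_num) |>.1 ?_)
  have hT : (-(c₁ : ℂ) * (2 * Complex.I) + c₂ * (1 - -1)) =
    -2 * Complex.I * (c₁ + c₂ * Complex.I) := by linear_combination (2 * c₂ : ℂ) * Complex.I_sq
  have hR : ((c₁ : ℂ) * (1 - -1) + c₂ * (2 * Complex.I)) = 2 * (c₁ + c₂ * Complex.I) := by ring
  have hT2 : (-2 * Complex.I * (c₁ + c₂ * Complex.I)) ^ 2 = -4 * (c₁ + c₂ * Complex.I) ^ 2 := by
    rw [mul_pow, mul_pow, Complex.I_sq]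
    ring
  rw [hT, hR, hT2] at hI
  linear_combination hI / 384

/-- Without `c₁` and `c₂` the trigonometric degree drops to 3, and the value at `u = i` is `96 (m₁ +
i m₂)³`. -/
theorem horizontal_eq_zero_of_equator {k l s c₃ m₁ m₂ m₃ : ℝ}
    (h : ∀ θ mr mt D : ℝ, mr = radial m₁ m₂ θ → mt = tangential m₁ m₂ θ →
      D = k + 2 * mr - c₃ ^ 2 →
      D * (2 * D ^ 2 - D * (2 * s ^ 2 + 4 * l + 2 * c₃ ^ 2) + 2 * (mt ^ 2 + m₃ ^ 2)
      + 4 * s ^ 2 * c₃ ^ 2 - 8 * s * (c₃ * mt)) = 0) :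
    m₁ = 0 ∧ m₂ = 0 := by
  let w : ℝ[X] := 1 + X ^ 2
  let Mr : ℝ[X] := C m₁ * (1 - X ^ 2) + C m₂ * (2 * X)
  let Mt : ℝ[X] := -C m₁ * (2 * X) + C m₂ * (1 - X ^ 2)
  let D : ℝ[X] := C k * w + 2 * Mr - C c₃ ^ 2 * w
  let P : ℝ[X] := D * (2 * D ^ 2 - D * (2 * C s ^ 2 + 4 * C l + 2 * C c₃ ^ 2) * w
      + 2 * (Mt ^ 2 + C m₃ ^ 2 * w ^ 2) + 4 * C s ^ 2 * C c₃ ^ 2 * w ^ 2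
      - 8 * C s * (C c₃ * Mt) * w)
  have hP : ∀ u : ℝ, P.eval u = 0 := by
    intro u
    have hw : (1 + u ^ 2) ≠ 0 := by positivity
    have h1 := h (2 * Real.arctan u) _ _ _ rfl rfl rfl
    simp only [radial_two_mul_arctan, tangential_two_mul_arctan] at h1
    have h2 : P.eval u = (1 + u ^ 2) ^ 3 * 0 := by
      rw [← h1]
      simp only [P, D, Mr, Mt, w, eval_add, eval_sub, eval_mul, eval_pow, eval_neg, eval_C,
        eval_X, eval_one, eval_ofNat]
      generalize m₁ * (1 - u ^ 2) + m₂ * (2 * u) = Mr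
      generalize -m₁ * (2 * u) + m₂ * (1 - u ^ 2) = Mt
      generalize 1 + u ^ 2 = w at hw
      field_simp
    simpa using h2
  have hI := aeval_I_eq_zero hP
  simp only [P, D, Mr, Mt, w, map_add, map_sub, map_mul, map_pow, map_neg, aeval_C,
    aeval_X, map_one, map_ofNat, Complex.coe_algebraMap, Complex.I_sq] at hI
  refine eq_zero_of_add_mul_I (pow_eq_zero_iff (n := 3) (by norm_num) |>.1 ?_)
  have hT : (-(m₁ : ℂ) * (2 * Complex.I) + m₂ * (1 - -1)) =
    -2 * Complex.I * (m₁ + m₂ * Complex.I) := by linear_combination (2 * m₂ : ℂ) * Complex.I_sq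
  have hR : ((m₁ : ℂ) * (1 - -1) + m₂ * (2 * Complex.I)) = 2 * (m₁ + m₂ * Complex.I) := by ring
  have hT2 : (-2 * Complex.I * (m₁ + m₂ * Complex.I)) ^ 2 = -4 * (m₁ + m₂ * Complex.I) ^ 2 := by
    rw [mul_pow, mul_pow, Complex.I_sq]
    ring
  rw [hT, hR, hT2] at hI
  linear_combination hI / 96

/-- The identity is polynomial in `S = sin φ` and holds on `(-1, 1)`, hence for all real `S`,
including values that are not sines. -/
theorem vertical_eq_zero_of_axial {k l s c₃ m₃ : ℝ}
    (h : ∀ φ S D : ℝ, S = Real.sin φ → Real.cos φ ≠ 0 →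
      D = k + 2 * m₃ * S - c₃ ^ 2 * (1 - S ^ 2) →
      D * (2 * D ^ 2 - D * (2 * s ^ 2 + 4 * l + 2 * c₃ ^ 2 - 6 * (c₃ * S) ^ 2)
      + (1 - S ^ 2) * (2 * m₃ ^ 2 + 4 * c₃ ^ 2 * m₃ * S + 2 * c₃ ^ 4 * S ^ 2
        + 4 * s ^ 2 * c₃ ^ 2)) = 0) :
    c₃ = 0 ∧ m₃ = 0 ∧ (k = 0 ∨ k = s ^ 2 + 2 * l) := by
  let D : ℝ[X] := C k + 2 * C m₃ * X - C c₃ ^ 2 * (1 - X ^ 2)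
  let P : ℝ[X] := D * (2 * D ^ 2
    - D * (2 * C s ^ 2 + 4 * C l + 2 * C c₃ ^ 2 - 6 * (C c₃ * X) ^ 2)
      + (1 - X ^ 2) * (2 * C m₃ ^ 2 + 4 * C c₃ ^ 2 * C m₃ * X + 2 * C c₃ ^ 4 * X ^ 2
        + 4 * C s ^ 2 * C c₃ ^ 2))
  have hP : P = 0 := by
    refine Polynomial.eq_zero_of_infinite_isRoot P
      ((Set.Ioo_infinite (show (-1 : ℝ) < 1 by norm_num)).mono fun S hS => ?_)
    have hsin := Real.sin_arcsin hS.1.le hS.2.le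
    have hcos : Real.cos (Real.arcsin S) ≠ 0 := by
      rw [Real.cos_arcsin]
      have : 0 < 1 - S ^ 2 := by nlinarith [hS.1, hS.2]
      positivity
    have h1 := h (Real.arcsin S) S _ hsin.symm hcos rfl
    simp only [Set.mem_ofPred_eq, IsRoot.def, P, D, eval_add, eval_sub, eval_mul, eval_pow, eval_C,
      eval_X, eval_one, eval_ofNat]
    exact h1
  have hev : ∀ S : ℝ, P.eval S = 0 := fun S => by rw [hP, eval_zero]
  simp only [P, D, eval_add, eval_sub, eval_mul, eval_pow, eval_C, eval_X, eval_one,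
    eval_ofNat] at hev
  have hc : c₃ = 0 := by
    refine (pow_eq_zero_iff (n := 6) (by norm_num)).1 ?_
    -- The sixth difference is `6!` times the leading coefficient `6 c₃⁶`.
    linear_combination (hev 3 - 6 * hev 2 + 15 * hev 1 - 20 * hev 0 + 15 * hev (-1)
      - 6 * hev (-2) + hev (-3)) / 4320
  subst hc
  have hm : m₃ = 0 := by
    refine (pow_eq_zero_iff (n := 3) (by norm_num)).1 ?_
    -- With `c₃ = 0` the degree is 3 and the third difference is `3!` times `12 m₃³`.
    linear_combination (hev 3 - 3 * hev 2 + 3 * hev 1 - hev 0) / 72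
  subst hm
  refine ⟨rfl, rfl, ?_⟩
  have h0 := hev 0
  rcases eq_or_ne k 0 with hk | hk
  · exact Or.inl hk
  · refine Or.inr ?_
    refine mul_left_cancel₀ (pow_ne_zero 2 hk) ?_
    -- What remains is `2 k² (k - s² - 2 l) = 0`.
    linear_combination h0 / 2

end

/-- If the scalar curvature of a surface with first fundamental form `kinMetric` vanishes at
`t = 0`, then the rotation and the scalar products with the translation vanish. -/
theorem eq_zero_of_scalarCurvature_eq_zero {k l s c₁ c₂ c₃ m₁ m₂ m₃ : ℝ}
    {X : (Fin 3 → ℝ) → E7} (hX : ∀ q, metric X q = kinMetric k l s c₁ c₂ c₃ m₁ m₂ m₃ q)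
    (hK : ∀ θ φ : ℝ, (metric X ![0, θ, φ]).det ≠ 0 → scalarCurvature X ![0, θ, φ] = 0) :
    (c₁ = 0 ∧ c₂ = 0 ∧ c₃ = 0) ∧ (m₁ = 0 ∧ m₂ = 0 ∧ m₃ = 0) ∧ (k = 0 ∨ k = s ^ 2 + 2 * l) := by
  obtain ⟨rfl, rfl⟩ := rotation_eq_zero_of_equator
    fun θ r τ mr mt D hr hτ hmr hmt hD => equator_identity hX hK hr hτ hmr hmt hD
  obtain ⟨rfl, rfl⟩ := horizontal_eq_zero_of_equator (k := k) (l := l) (s := s) (c₃ := c₃)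
      (m₁ := m₁) (m₂ := m₂) (m₃ := m₃) fun θ mr mt D hmr hmt hD => by
    have h := equator_identity hX hK (θ := θ) (r := 0) (τ := 0) (D := D) (by simp [radial])
      (by simp [tangential]) hmr hmt (by rw [hD]; ring)
    linear_combination h
  obtain ⟨rfl, rfl, h⟩ := vertical_eq_zero_of_axial
    fun φ S D hS hC hD => axial_identity hX hK hS hC hD
  exact ⟨⟨rfl, rfl, rfl⟩, ⟨rfl, rfl, rfl⟩, h⟩

/-! ### The first fundamental form of an affinely moving sphere -/

/-- A motion of the unit sphere that is affine in the time `t = p 0`: the vectors `e i` move with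
the velocities `w i`, the centre with the velocity `d`. -/
def movingSphere (e w : Fin 3 → E7) (d : E7) (p : Fin 3 → ℝ) : E7 :=
  (Real.cos (p 1) * Real.cos (p 2)) • (e 0 + p 0 • w 0)
    + (Real.sin (p 1) * Real.cos (p 2)) • (e 1 + p 0 • w 1)
    + Real.sin (p 2) • (e 2 + p 0 • w 2) + p 0 • d

section

variable (e w : Fin 3 → E7) (d : E7) (p : Fin 3 → ℝ)

theorem pderiv_zero_movingSphere : pderiv 0 (movingSphere e w d) p =
    (Real.cos (p 1) * Real.cos (p 2)) • w 0 + (Real.sin (p 1) * Real.cos (p 2)) • w 1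
    + Real.sin (p 2) • w 2 + d := by
  have h : ∀ v : E7, HasDerivAt (fun τ : ℝ => τ • v) v (p 0) := fun v => by
    simpa using (hasDerivAt_id (p 0)).smul_const v
  have h1 : ∀ i, HasDerivAt (fun τ : ℝ => e i + τ • w i) (w i) (p 0) := fun i =>
    (h (w i)).const_add (e i)
  exact (((((h1 0).const_smul (Real.cos (p 1) * Real.cos (p 2))).add
    ((h1 1).const_smul (Real.sin (p 1) * Real.cos (p 2)))).add
    ((h1 2).const_smul (Real.sin (p 2)))).add (h d)).deriv

theorem pderiv_one_movingSphere : pderiv 1 (movingSphere e w d) p =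
    (-Real.sin (p 1) * Real.cos (p 2)) • (e 0 + p 0 • w 0)
    + (Real.cos (p 1) * Real.cos (p 2)) • (e 1 + p 0 • w 1) :=
  (((((Real.hasDerivAt_cos (p 1)).mul_const (Real.cos (p 2))).smul_const (e 0 + p 0 • w 0)).add
    (((Real.hasDerivAt_sin (p 1)).mul_const (Real.cos (p 2))).smul_const
      (e 1 + p 0 • w 1))).add_const (Real.sin (p 2) • (e 2 + p 0 • w 2))
    |>.add_const (p 0 • d)).deriv

theorem pderiv_two_movingSphere : pderiv 2 (movingSphere e w d) p =
    (Real.cos (p 1) * -Real.sin (p 2)) • (e 0 + p 0 • w 0)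
    + (Real.sin (p 1) * -Real.sin (p 2)) • (e 1 + p 0 • w 1)
    + Real.cos (p 2) • (e 2 + p 0 • w 2) :=
  (((((Real.hasDerivAt_cos (p 2)).const_mul (Real.cos (p 1))).smul_const (e 0 + p 0 • w 0)).add
    (((Real.hasDerivAt_cos (p 2)).const_mul (Real.sin (p 1))).smul_const (e 1 + p 0 • w 1))).add
    ((Real.hasDerivAt_sin (p 2)).smul_const (e 2 + p 0 • w 2))
    |>.add_const (p 0 • d)).deriv

variable {e w d}

/-- `hew` says that, within the starting 3-space, `w j` is `s e j` plus the cross product of `(c₁,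
c₂, c₃)` with `e j`. With `hww` the vectors `e i + t w i` stay orthogonal with common squared length
`radiusSq s l t`. -/
theorem metric_movingSphere {s l B c₁ c₂ c₃ m₁ m₂ m₃ : ℝ}
    (hee : ∀ i j, inner ℝ (e i) (e j) = if i = j then 1 else 0)
    (hew : ∀ i j, inner ℝ (e i) (w j) =
      !![s, -c₃, c₂; c₃, s, -c₁; -c₂, c₁, s] i j)
    (hww : ∀ i j, inner ℝ (w i) (w j) = if i = j then s ^ 2 + l else 0)
    (hed : ∀ i, inner ℝ (e i) d = 0) (hwd : ∀ i, inner ℝ (w i) d = ![m₁, m₂, m₃] i)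
    (hdd : inner ℝ d d = B) :
    metric (movingSphere e w d) p = kinMetric (s ^ 2 + l + B) l s c₁ c₂ c₃ m₁ m₂ m₃ p := by
  have hdw : ∀ i, inner ℝ d (w i) = ![m₁, m₂, m₃] i := fun i => by
    rw [real_inner_comm, hwd]
  have huu : ∀ i j, inner ℝ (e i + p 0 • w i) (e j + p 0 • w j) =
      if i = j then radiusSq s l (p 0) else 0 := by
    intro i j
    simp only [inner_add_left, inner_add_right, real_inner_smul_left, real_inner_smul_right,
      hee, hww, hew, real_inner_comm (e j) (w i)]
    fin_cases i <;> fin_cases j <;> simp [radiusSq] <;> ring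
  have hwu : ∀ i j, inner ℝ (w i) (e j + p 0 • w j) =
      !![s + p 0 * (s ^ 2 + l), c₃, -c₂; -c₃, s + p 0 * (s ^ 2 + l), c₁;
        c₂, -c₁, s + p 0 * (s ^ 2 + l)] i j := by
    intro i j
    simp only [inner_add_right, real_inner_smul_right, hww, hew, real_inner_comm (e j) (w i)]
    fin_cases i <;> fin_cases j <;> simp
  have hdu : ∀ i, inner ℝ d (e i + p 0 • w i) = p 0 * ![m₁, m₂, m₃] i := by
    intro i
    rw [inner_add_right, real_inner_smul_right, hdw, real_inner_comm, hed, zero_add]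
  -- Hiding the sums behind `u` keeps bilinear expansion from splitting them.
  obtain ⟨u, hu⟩ : ∃ u : Fin 3 → E7, ∀ i, e i + p 0 • w i = u i := ⟨_, fun _ => rfl⟩
  simp only [hu] at huu hwu hdu
  have h1 := Real.sin_sq_add_cos_sq (p 1)
  have h2 := Real.sin_sq_add_cos_sq (p 2)
  have hsymm : ∀ i j, metric (movingSphere e w d) p i j = metric (movingSphere e w d) p j i :=
    fun i j => real_inner_comm (pderiv j (movingSphere e w d) p) _
  have h00 : metric (movingSphere e w d) p 0 0 = s ^ 2 + l + B
      + 2 * (radial m₁ m₂ (p 1) * Real.cos (p 2) + m₃ * Real.sin (p 2)) := by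
    simp only [metric, Matrix.of_apply, pderiv_zero_movingSphere, inner_add_left, inner_add_right,
      real_inner_smul_left, real_inner_smul_right, hww, hwd, hdw, hdd]
    simp [radial]
    linear_combination (s ^ 2 + l) * (Real.cos (p 2) ^ 2 * h1 + h2)
  have h01 : metric (movingSphere e w d) p 0 1 =
      Real.cos (p 2) * (c₃ * Real.cos (p 2) - radial c₁ c₂ (p 1) * Real.sin (p 2))
      + p 0 * (Real.cos (p 2) * tangential m₁ m₂ (p 1)) := by
    simp only [metric, Matrix.of_apply, pderiv_zero_movingSphere, pderiv_one_movingSphere, hu,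
      inner_add_left, inner_add_right, real_inner_smul_left, real_inner_smul_right, hwu, hdu]
    simp [radial, tangential]
    linear_combination c₃ * Real.cos (p 2) ^ 2 * h1
  have h02 : metric (movingSphere e w d) p 0 2 = -tangential c₁ c₂ (p 1)
      + p 0 * (-radial m₁ m₂ (p 1) * Real.sin (p 2) + m₃ * Real.cos (p 2)) := by
    simp only [metric, Matrix.of_apply, pderiv_zero_movingSphere, pderiv_two_movingSphere, hu,
      inner_add_left, inner_add_right, real_inner_smul_left, real_inner_smul_right, hwu, hdu]
    simp [radial, tangential]
    linear_combination (c₁ * Real.sin (p 1) - c₂ * Real.cos (p 1)) * h2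
      - (s + p 0 * (s ^ 2 + l)) * Real.cos (p 2) * Real.sin (p 2) * h1
  have h11 : metric (movingSphere e w d) p 1 1 = radiusSq s l (p 0) * Real.cos (p 2) ^ 2 := by
    simp only [metric, Matrix.of_apply, pderiv_one_movingSphere, hu,
      inner_add_left, inner_add_right, real_inner_smul_left, real_inner_smul_right, huu]
    simp
    linear_combination radiusSq s l (p 0) * Real.cos (p 2) ^ 2 * h1
  have h12 : metric (movingSphere e w d) p 1 2 = 0 := by
    simp only [metric, Matrix.of_apply, pderiv_one_movingSphere, pderiv_two_movingSphere, hu,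
      inner_add_left, inner_add_right, real_inner_smul_left, real_inner_smul_right, huu]
    simp
    ring
  have h22 : metric (movingSphere e w d) p 2 2 = radiusSq s l (p 0) := by
    simp only [metric, Matrix.of_apply, pderiv_two_movingSphere, hu,
      inner_add_left, inner_add_right, real_inner_smul_left, real_inner_smul_right, huu]
    simp
    linear_combination radiusSq s l (p 0) * (Real.sin (p 2) ^ 2 * h1 + h2)
  ext i j
  fin_cases i <;> fin_cases j
  · exact h00
  · exact h01
  · exact h02
  · exact (hsymm 1 0).trans h01
  · exact h11
  · exact h12
  · exact (hsymm 2 0).trans h02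
  · exact (hsymm 2 1).trans h12
  · exact h22

end

/-! ### What roundness of a slice implies -/

/-- The centre of a sphere swept out by a point-symmetric set is the centre of symmetry. -/
theorem IsTwoSphere.exists_norm_eq {S : Set E7} (hS : IsTwoSphere S) {z : E7}
    (hz : ∀ y, z + y ∈ S → z - y ∈ S) : ∃ r : ℝ, ∀ y, z + y ∈ S → ‖y‖ = r := by
  obtain ⟨c, r, W, hr, hW, rfl⟩ := hS
  have hnt : Nontrivial W := Module.nontrivial_of_finrank_pos (R := ℝ) (by omega)
  obtain ⟨v, hv⟩ := exists_ne (0 : W)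
  have hv' : ‖(v : E7)‖ ≠ 0 := by simpa using hv
  -- Reflecting the point `c + x` of the sphere in `z` gives another point of the sphere. Using this
  -- for both `x` and `-x` and adding the squared norms leaves `z - c = 0`.
  have key : ∀ x ∈ W, ‖x‖ = r → ‖x‖ = ‖x - (2 : ℝ) • (z - c)‖ := by
    intro x hx hxr
    have h := hz (c + x - z) (by simpa using ⟨hx, hxr⟩)
    rw [hxr, ← h.2, ← norm_neg]
    congr 1
    module
  have hx : (r * ‖(v : E7)‖⁻¹) • (v : E7) ∈ W := W.smul_mem _ v.2
  have hxr : ‖(r * ‖(v : E7)‖⁻¹) • (v : E7)‖ = r := by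
    rw [norm_smul, Real.norm_of_nonneg (by positivity), mul_assoc, inv_mul_cancel₀ hv', mul_one]
  have h1 := key _ hx hxr
  have h2 := key _ (W.neg_mem hx) (by rw [norm_neg, hxr])
  generalize (r * ‖(v : E7)‖⁻¹) • (v : E7) = x at h1 h2
  have h3 : ‖x‖ ^ 2 = ‖x - (2 : ℝ) • (z - c)‖ ^ 2 := by rw [← h1]
  have h4 : ‖-x‖ ^ 2 = ‖-x - (2 : ℝ) • (z - c)‖ ^ 2 := by rw [← h2]
  rw [norm_sub_sq_real] at h3 h4
  rw [inner_neg_left] at h4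
  have h5 : ‖(2 : ℝ) • (z - c)‖ = 0 := by
    refine (pow_eq_zero_iff (n := 2) (by norm_num)).1 ?_
    linarith
  have h6 : z = c := by
    rw [norm_eq_zero, smul_eq_zero, sub_eq_zero] at h5
    simpa using h5
  exact ⟨r, fun y hy => by simpa [h6] using hy.2⟩

section

variable {e w : Fin 3 → E7} {d : E7}

theorem movingSphere_apply (t θ φ : ℝ) : movingSphere e w d ![t, θ, φ] =
    t • d + ((Real.cos θ * Real.cos φ) • (e 0 + t • w 0)
    + (Real.sin θ * Real.cos φ) • (e 1 + t • w 1) + Real.sin φ • (e 2 + t • w 2)) := by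
  simp only [movingSphere, Matrix.cons_val]
  abel

theorem inner_eq_zero_of_norm_eq {u v : E7} {r : ℝ} (hu : ‖u‖ = r) (hv : ‖v‖ = r)
    (h : ‖(√2 / 2) • u + (√2 / 2) • v‖ = r) : inner ℝ u v = 0 := by
  have h1 : ‖(√2 / 2) • u + (√2 / 2) • v‖ ^ 2 = r ^ 2 := by rw [h]
  rw [← smul_add, norm_smul, mul_pow, norm_add_sq_real, hu, hv, Real.norm_eq_abs, sq_abs, div_pow,
    Real.sq_sqrt (by norm_num)] at h1
  linarith

/-- If some slice `t ≠ 0` is a round sphere, then the velocities of the frame are orthogonal and of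
equal length. -/
theorem exists_inner_velocity_eq {s t : ℝ} (ht : t ≠ 0)
    (hee : ∀ i j, inner ℝ (e i) (e j) = if i = j then 1 else 0)
    (hew : ∀ i j, inner ℝ (e i) (w j) + inner ℝ (e j) (w i) = if i = j then 2 * s else 0)
    (hS : IsTwoSphere (Set.range fun q : ℝ × ℝ => movingSphere e w d ![t, q.1, q.2])) :
    ∃ l : ℝ, ∀ i j, inner ℝ (w i) (w j) = if i = j then s ^ 2 + l else (0 : ℝ) := by
  obtain ⟨r, hr⟩ := hS.exists_norm_eq (z := t • d) (by
    rintro y ⟨q, hq⟩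
    -- These are the coordinates of the antipodal point.
    refine ⟨(q.1 + Real.pi, -q.2), ?_⟩
    simp only [movingSphere_apply] at hq ⊢
    rw [← add_left_cancel hq, Real.cos_add_pi, Real.sin_add_pi, Real.cos_neg, Real.sin_neg]
    module)
  have hN : ∀ θ φ : ℝ, ‖(Real.cos θ * Real.cos φ) • (e 0 + t • w 0)
      + (Real.sin θ * Real.cos φ) • (e 1 + t • w 1) + Real.sin φ • (e 2 + t • w 2)‖ = r :=
    fun θ φ => hr _ ⟨(θ, φ), movingSphere_apply t θ φ⟩
  have huu : ∀ i j, inner ℝ (e i + t • w i) (e j + t • w j) =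
      (if i = j then (1 + t * (2 * s)) else 0) + t ^ 2 * inner ℝ (w i) (w j) := by
    intro i j
    have h : (inner ℝ (e i + t • w i) (e j + t • w j) : ℝ) = inner ℝ (e i) (e j)
        + t * (inner ℝ (e i) (w j) + inner ℝ (e j) (w i)) + t ^ 2 * inner ℝ (w i) (w j) := by
      simp only [inner_add_left, inner_add_right, real_inner_smul_left, real_inner_smul_right,
        real_inner_comm (e j) (w i)]
      ring
    rw [h, hee, hew]
    split_ifs <;> ring
  -- Angles `0` and `π / 2` give the lengths of the three vectors; `π / 4` gives the combinations
  -- with weights `√2 / 2`, whose length forces orthogonality.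
  have h0 : ‖e 0 + t • w 0‖ = r := by simpa using hN 0 0
  have h1 : ‖e 1 + t • w 1‖ = r := by simpa using hN (Real.pi / 2) 0
  have h2 : ‖e 2 + t • w 2‖ = r := by simpa using hN 0 (Real.pi / 2)
  have h01 := inner_eq_zero_of_norm_eq h0 h1 (by simpa using hN (Real.pi / 4) 0)
  have h02 := inner_eq_zero_of_norm_eq h0 h2 (by simpa using hN 0 (Real.pi / 4))
  have h12 := inner_eq_zero_of_norm_eq h1 h2 (by simpa using hN (Real.pi / 2) (Real.pi / 4))
  have hrr : ∀ i j, inner ℝ (e i + t • w i) (e j + t • w j) = if i = j then r ^ 2 else 0 := by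
    intro i j
    fin_cases i <;> fin_cases j <;>
      simp [h0, h1, h2, h01, h02, h12, (real_inner_comm _ _).trans h01,
        (real_inner_comm _ _).trans h02, (real_inner_comm _ _).trans h12]
  refine ⟨(r ^ 2 - (1 + t * (2 * s))) / t ^ 2 - s ^ 2, fun i j => ?_⟩
  have h := (huu i j).symm.trans (hrr i j)
  split_ifs at h ⊢
  · field_simp
    linarith
  · simpa [ht] using h

end

end LocalGeometry

/-! ### Equiform motions as moving spheres -/

namespace EquiformMotion

section

variable (M : EquiformMotion)

/-- The first three vectors of the standard basis. -/
def frame (i : Fin 3) : E7 := EuclideanSpace.single (Fin.castLE (by norm_num) i) 1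

/-- The velocities of the vectors `frame i`. -/
def velocity (i : Fin 3) : E7 :=
  WithLp.toLp 2 fun j => M.s' * frame i j + M.Omega j (Fin.castLE (by norm_num) i)

theorem castLE_one : Fin.castLE (by norm_num : 3 ≤ 7) 1 = 1 := rfl

theorem castLE_two : Fin.castLE (by norm_num : 3 ≤ 7) 2 = 2 := rfl

theorem surface_eq_movingSphere :
    M.surface = LocalGeometry.movingSphere frame M.velocity M.d' := by
  ext p j
  fin_cases j <;>
  · simp [surface, X, LocalGeometry.movingSphere, sphereParam, frame, velocity, Matrix.mulVec,
      dotProduct, Fin.sum_univ_seven, Matrix.one_apply, castLE_one, castLE_two]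
    ring

/-- Differentiate `Aᵀ A = 1` at `0`, where `A = 1`. -/
theorem Omega_skew (i j : Fin 7) : M.Omega j i = -M.Omega i j := by
  have hI : M.I ∈ 𝓝 (0 : ℝ) := M.isOpen_I.mem_nhds M.zero_mem_I
  have hA : ∀ i j, HasDerivAt (fun t => M.A t i j) (M.Omega i j) 0 := fun i j =>
    (((M.contDiffOn_A i j).contDiffAt hI).differentiableAt (by norm_num)).hasDerivAt
  have h1 : HasDerivAt (fun t => ∑ k, M.A t k i * M.A t k j)
      (∑ k, (M.Omega k i * M.A 0 k j + M.A 0 k i * M.Omega k j)) 0 :=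
    HasDerivAt.fun_sum fun k _ => (hA k i).mul (hA k j)
  have h2 : (fun t => ∑ k, M.A t k i * M.A t k j) =ᶠ[𝓝 0]
      fun _ => (1 : Matrix (Fin 7) (Fin 7) ℝ) i j := by
    filter_upwards [hI] with t ht
    rw [← (Matrix.mem_orthogonalGroup_iff' (Fin 7) ℝ).1 (M.A_orthogonal t ht)]
    rfl
  have h3 := (h1.congr_of_eventuallyEq h2.symm).unique (hasDerivAt_const 0 _)
  rw [M.A_zero] at h3
  simp only [Matrix.one_apply, mul_ite, ite_mul, mul_one, mul_zero, one_mul, zero_mul,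
    Finset.sum_add_distrib, Finset.sum_ite_eq', Finset.mem_univ, if_true] at h3
  linarith

theorem inner_frame (i : Fin 3) (v : E7) :
    inner ℝ (frame i) v = v (Fin.castLE (by norm_num) i) := by
  simp [frame, EuclideanSpace.inner_single_left]

theorem inner_frame_frame (i j : Fin 3) :
    inner ℝ (frame i) (frame j) = if i = j then (1 : ℝ) else 0 := by
  rw [inner_frame]
  simp [frame, Fin.ext_iff]

theorem inner_frame_velocity (i j : Fin 3) :
    inner ℝ (frame i) (M.velocity j) = M.s' * (if i = j then (1 : ℝ) else 0)
      + M.Omega (Fin.castLE (by norm_num) i) (Fin.castLE (by norm_num) j) := by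
  rw [inner_frame]
  simp [velocity, frame, Fin.ext_iff]

end

end EquiformMotion

end

theorem mainTheorem4 (M : EquiformMotion)
    (hS : M.FoliatedBySpheres)
    (hb : M.b' 1 = 0 ∧ M.b' 2 = 0 ∧ M.b' 3 = 0)
    (hK : ∀ θ φ : ℝ, (LocalGeometry.metric M.surface ![0, θ, φ]).det ≠ 0 →
      LocalGeometry.scalarCurvature M.surface ![0, θ, φ] = 0) :
    (M.ω 1 = 0 ∧ M.ω 2 = 0 ∧ M.ω 7 = 0) ∧
    (∑ i ∈ Finset.Icc 4 7, M.b' i * M.ω (i - 1) = 0 ∧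
      ∑ i ∈ Finset.Icc 4 7, M.b' i * M.ω (i + 4) = 0 ∧
      ∑ i ∈ Finset.Icc 4 7, M.b' i * M.ω (i + 8) = 0) ∧
    ∑ i ∈ Finset.Icc 3 6, M.ω i ^ 2 = ∑ i ∈ Finset.Icc 4 7, M.b' i ^ 2 := by
  -- One round slice with `t ≠ 0` suffices.
  obtain ⟨t, ht, ht0⟩ : ∃ t, LocalGeometry.IsTwoSphere
      (Set.range fun q : ℝ × ℝ => M.X t q.1 q.2) ∧ t ≠ 0 :=
    ((hS.filter_mono nhdsWithin_le_nhds).and self_mem_nhdsWithin : ∀ᶠ t in 𝓝[≠] (0 : ℝ),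
      LocalGeometry.IsTwoSphere (Set.range fun q : ℝ × ℝ => M.X t q.1 q.2) ∧ t ≠ 0).exists
  have hX : ∀ θ φ, M.X t θ φ =
      LocalGeometry.movingSphere EquiformMotion.frame M.velocity M.d' ![t, θ, φ] := fun θ φ => by
    rw [← M.surface_eq_movingSphere]
    rfl
  simp only [hX] at ht
  obtain ⟨l, hl⟩ := LocalGeometry.exists_inner_velocity_eq (s := M.s') ht0
    EquiformMotion.inner_frame_frame (fun i j => by
      rw [M.inner_frame_velocity, M.inner_frame_velocity, M.Omega_skew]
      by_cases h : i = j
      · subst h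
        simp
        ring
      · simp [h, Ne.symm h]) ht
  have hdiag : ∀ i, M.Omega i i = 0 := fun i => by linarith [M.Omega_skew i i]
  have hd : ∀ i, inner ℝ (EquiformMotion.frame i) M.d' = (0 : ℝ) := by
    intro i
    rw [EquiformMotion.inner_frame]
    fin_cases i
    exacts [hb.1, hb.2.1, hb.2.2]
  have hmetric := fun q => LocalGeometry.metric_movingSphere (B := inner ℝ M.d' M.d')
    (c₁ := -M.Omega 1 2) (c₂ := M.Omega 0 2) (c₃ := -M.Omega 0 1)
    (m₁ := inner ℝ (M.velocity 0) M.d') (m₂ := inner ℝ (M.velocity 1) M.d')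
    (m₃ := inner ℝ (M.velocity 2) M.d') q EquiformMotion.inner_frame_frame
    (fun i j => by
      rw [M.inner_frame_velocity]
      fin_cases i <;> fin_cases j <;>
        simp [Fin.castLE, hdiag, M.Omega_skew 0 1, M.Omega_skew 0 2, M.Omega_skew 1 2])
    hl hd (fun i => by fin_cases i <;> rfl) rfl
  rw [← M.surface_eq_movingSphere] at hmetric
  obtain ⟨⟨hc1, hc2, hc3⟩, ⟨hm1, hm2, hm3⟩, hk⟩ :=
    LocalGeometry.eq_zero_of_scalarCurvature_eq_zero hmetric hK
  have hl0 := hl 0 0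
  obtain ⟨hb1, hb2, hb3⟩ := hb
  simp only [EquiformMotion.b'] at hb1 hb2 hb3
  have hc1' : M.Omega 1 2 = 0 := by linarith
  have hc3' : M.Omega 0 1 = 0 := by linarith
  simp [PiLp.inner_apply, Fin.sum_univ_seven, EquiformMotion.velocity, EquiformMotion.frame,
    EquiformMotion.castLE_one, EquiformMotion.castLE_two, hdiag,
    M.Omega_skew 0 1, M.Omega_skew 0 2, M.Omega_skew 0 3, M.Omega_skew 0 4, M.Omega_skew 0 5,
    M.Omega_skew 0 6, M.Omega_skew 1 2, M.Omega_skew 1 3, M.Omega_skew 1 4, M.Omega_skew 1 5,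
    M.Omega_skew 1 6, M.Omega_skew 2 3, M.Omega_skew 2 4, M.Omega_skew 2 5, M.Omega_skew 2 6,
    hb1, hb2, hb3, hc1', hc2, hc3'] at hm1 hm2 hm3 hk hl0
  simp [EuclideanSpace.real_norm_sq_eq, Fin.sum_univ_seven, hdiag, hb1, hb2, hb3, hc2, hc3',
    M.Omega_skew 0 1, M.Omega_skew 0 2, M.Omega_skew 0 3, M.Omega_skew 0 4, M.Omega_skew 0 5,
    M.Omega_skew 0 6] at hk hl0
  simp only [show Finset.Icc 4 7 = {4, 5, 6, 7} from rfl,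
    show Finset.Icc 3 6 = {3, 4, 5, 6} from rfl]
  simp [EquiformMotion.ω, EquiformMotion.b', hc1', hc2, hc3']
  refine ⟨⟨by linarith, by linarith, by linarith⟩, ?_⟩
  -- In the case `k = 0`, `k` is the sum of the squared lengths of `w 0` and `d'`, so both vanish
  -- and the two sides are zero. In the other case `|d'|² = l`, and `hl0` identifies `l` with the
  -- sum of the `ωᵢ²`.
  rcases hk with hk | hk
  · nlinarith [sq_nonneg M.s', sq_nonneg (M.d' 3), sq_nonneg (M.d' 4), sq_nonneg (M.d' 5),
      sq_nonneg (M.d' 6), sq_nonneg (M.Omega 0 3), sq_nonneg (M.Omega 0 4),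
      sq_nonneg (M.Omega 0 5), sq_nonneg (M.Omega 0 6)]
  · linarith
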